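/- Let $X$ be a Noetherian scheme and let $Z$ be a (possibly infinite) collection of effective Cartier divisors on $X$. Write $\mathcal O_X(*Z)=\bigcup_P \mathcal I_P^{-1}$ (union over all finite sums $P$ of members of $Z$, with multiplicities) for the push-forward to $X$ of the structure sheaf of $X\setminus Z$, considered inside the sheaf of total rings of fractions. A \emph{fractional ideal} relative to $Z$ is an $\mathcal O_X$-submodule of $\mathcal O_X(*Z)$ locally of finite type. The \emph{zero locus} of a fractional ideal $J$ is the set of points $x\in X$ with $1\notin J_x$ (for an ideal $J\subseteq\mathcal O_X$ this is the usual zero locus). For a morphism $f:\tilde X\to X$, write $f^{-1}J$ for the $\mathcal O_{\tilde X}$-submodule generated by the image of $J$. Let $I\subseteq J$ be fractional ideals relative to $Z$ such that the zero locus of $J$ is contained in $\bigcup_{D\in Z} D$. Then the following are equivalent: (i) the extension is integral relative to $Z$: there is a finite type ideal sheaf $T\subseteq\mathcal O_X$ whose zero set is contained in $\bigcup_{D\in Z}D$ such that, for the blow-up $f:\tilde X\to X$ of $X$ along $T$, $f^{-1}I=f^{-1}J$; (i') for every collection $Z'$ of effective Cartier divisors on $X$ such that $J\subseteq\mathcal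 O_X(*Z')$ and the zero locus of $J$ is contained in $\bigcup_{D\in Z'}D$, the extension is integral relative to $Z'$ in the sense of (i); (ii) $J$ is integral over $I$ in the usual sense: over every affine open $V\subseteq X$, every $z\in J(V)$ satisfies an equation $z^n+c_1z^{n-1}+\cdots+c_n=0$ with $n\ge 1$ and $c_i\in I(V)^i$; (iii) $I$ and $J$ become equal after blowing up $J$: for the blow-up $f:\tilde X\to X$ of $X$ along $J$ (that is, along the ideal sheaf $D\cdot J\subseteq\mathcal O_X$ for any effective Cartier divisor $D$, with ideal also denoted $D$, such that $D\cdot J\subseteq\mathcal O_X$), $f^{-1}I=f^{-1}J$. -/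

import Mathlib

open AlgebraicGeometry CategoryTheory

universe u

noncomputable section

/-- For a ring homomorphism `φ : A → B` and an `A`-submodule `N` of the total ring of fractions of
`A`, the `B`-submodule of the total ring of fractions of `B` generated by the images of the
elements of `N`. The fraction `a / s` has the image `φ a / φ s` as soon as the non-zero-divisor `s`
maps to a non-zero-divisor; this image does not depend on the chosen representation. (For
restrictions to smaller affine opens and for blow-ups with centre cosupported in Cartier divisors
every non-zero-divisor maps to a non-zero-divisor, so every element of `N` has an image.) -/
def pullbackFractions {A B : Type u} [CommRing A] [CommRing B] (φ : A →+* B)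
    (N : Submodule A (FractionRing A)) : Submodule B (FractionRing B) :=
  Submodule.span B {y | ∃ (a s : A) (hs : s ∈ nonZeroDivisors A) (ht : φ s ∈ nonZeroDivisors B),
    IsLocalization.mk' (FractionRing A) a ⟨s, hs⟩ ∈ N ∧
      y = IsLocalization.mk' (FractionRing B) (φ a) ⟨φ s, ht⟩}

/-- The closed subscheme given by the ideal sheaf `D` is an effective Cartier divisor: locally, `D`
is generated by a non-zero-divisor. -/
def IsEffectiveCartier {X : Scheme.{u}} (D : X.IdealSheafData) : Prop :=
  ∀ x : X, ∃ V : X.affineOpens, x ∈ V.1 ∧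
    ∃ s ∈ nonZeroDivisors Γ(X, V.1), D.ideal V = Ideal.span {s}

/-- The morphism `f` is the blow-up of its target along the ideal sheaf `T`: the inverse image
ideal `T · 𝒪` is an effective Cartier divisor, and `f` is terminal with this property. -/
structure IsBlowup {X Y : Scheme.{u}} (f : Y ⟶ X) (T : X.IdealSheafData) : Prop where
  isEffectiveCartier : IsEffectiveCartier (T.comap f)
  existsUnique_lift : ∀ (W : Scheme.{u}) (g : W ⟶ X), IsEffectiveCartier (T.comap g) →
    ∃! h : W ⟶ Y, h ≫ f = g

/-- A quasi-coherent sheaf of finitely generated `𝒪`-submodules of the sheaf of total rings of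
fractions, given by its sections over the affine opens. -/
structure FractionalIdealSheaf (X : Scheme.{u}) where
  sections : ∀ V : X.affineOpens, Submodule Γ(X, V.1) (FractionRing Γ(X, V.1))
  fg : ∀ V, (sections V).FG
  map_basicOpen : ∀ (V : X.affineOpens) (g : Γ(X, V.1)),
    pullbackFractions (X.presheaf.map (homOfLE (X.basicOpen_le g)).op).hom (sections V) =
      sections (X.affineBasicOpen g)

namespace FractionalIdealSheaf

variable {X : Scheme.{u}}

instance : LE (FractionalIdealSheaf X) where
  le I J := ∀ V, I.sections V ≤ J.sections V

/-- The sections over the affine open `V` of the functions with poles along `Z` only, that is, of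
the push-forward to `X` of the structure sheaf of the complement of the divisors in `Z`. It is the
union of the sections of the inverses of all finite products of the ideals in `Z`. -/
def polarSections (Z : Set X.IdealSheafData) (V : X.affineOpens) :
    Set (FractionRing Γ(X, V.1)) :=
  {x | ∃ P ∈ Submonoid.closure Z, ∀ a ∈ P.ideal V,
    a • x ∈ (1 : Submodule Γ(X, V.1) (FractionRing Γ(X, V.1)))}

/-- `J` is a fractional ideal of the structure sheaf of the complement of `Z`. -/
def IsFractionalFor (J : FractionalIdealSheaf X) (Z : Set X.IdealSheafData) : Prop :=
  ∀ V, (J.sections V : Set (FractionRing Γ(X, V.1))) ⊆ polarSections Z V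

/-- The zero locus of `J`: the set of points `x` with `1 ∉ Jₓ`, that is, the set of common zeros of
the regular functions that belong to `J`. It is the usual zero locus if `J` is an ideal sheaf. -/
def zeroLocus (J : FractionalIdealSheaf X) : Set X :=
  {x | ∀ V : X.affineOpens, x ∈ V.1 → ∀ a : Γ(X, V.1),
    algebraMap Γ(X, V.1) (FractionRing Γ(X, V.1)) a ∈ J.sections V → x ∉ X.basicOpen a}

/-- The inverse images of `I` and `J` under `f` are the same sheaf of fractional ideals: their
sections agree on the affine opens that lie over an affine open, which form a basis. -/
def PullbackEq {Y : Scheme.{u}} (f : Y ⟶ X) (I J : FractionalIdealSheaf X) : Prop :=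
  ∀ (V : X.affineOpens) (W : Y.affineOpens) (h : W.1 ≤ f ⁻¹ᵁ V.1),
    pullbackFractions (f.appLE V.1 W.1 h).hom (I.sections V) =
      pullbackFractions (f.appLE V.1 W.1 h).hom (J.sections V)

/-- `I` and `J` become equal on the blow-up of `X` along some finite type ideal sheaf that is
cosupported set-theoretically in `Z`. -/
def IsIntegralExtension (Z : Set X.IdealSheafData) (I J : FractionalIdealSheaf X) : Prop :=
  ∃ T : X.IdealSheafData, (∀ V, (T.ideal V).FG) ∧
    (T.support : Set X) ⊆ ⋃ D ∈ Z, (D.support : Set X) ∧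
    ∃ (Y : Scheme.{u}) (f : Y ⟶ X), IsBlowup f T ∧ PullbackEq f I J

/-- Every local section `z` of `J` satisfies an equation of integral dependence over `I`:
`zⁿ + c₁ zⁿ⁻¹ + ⋯ + cₙ = 0` with `n ≥ 1` and `cᵢ ∈ Iⁱ`. -/
def IsIntegralOver (I J : FractionalIdealSheaf X) : Prop :=
  ∀ V, ∀ z ∈ J.sections V, ∃ (n : ℕ) (c : ℕ → FractionRing Γ(X, V.1)), 1 ≤ n ∧
    (∀ i ∈ Finset.Icc 1 n, c i ∈ I.sections V ^ i) ∧
    z ^ n + ∑ i ∈ Finset.Icc 1 n, c i * z ^ (n - i) = 0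

/-- The morphism `f` is the blow-up of `X` along the fractional ideal `J`: it is the blow-up along
an ideal sheaf `T` of the form `D · J` with an effective Cartier divisor `D`. (The blow-up does
not depend on the choice of `D`, since a twist by an invertible ideal does not change it.) -/
def IsBlowupAlong {Y : Scheme.{u}} (f : Y ⟶ X) (J : FractionalIdealSheaf X) : Prop :=
  ∃ D T : X.IdealSheafData, IsEffectiveCartier D ∧
    (∀ V, IsLocalization.coeSubmodule (FractionRing Γ(X, V.1)) (T.ideal V) =
      D.ideal V • J.sections V) ∧
    IsBlowup f T

/-- `I` becomes equal to `J` on the blow-up of `X` along `J`. -/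
def EqAfterBlowup (I J : FractionalIdealSheaf X) : Prop :=
  ∃ (Y : Scheme.{u}) (f : Y ⟶ X), IsBlowupAlong f J ∧ PullbackEq f I J

end FractionalIdealSheaf

end

/-!
The equivalence rests on three facts about the blow-up `f : Y ⟶ X` of an ideal sheaf `T`.

*From integral dependence to blow-ups.* Let `T = D J` with an effective Cartier divisor `D`. If `J`
is integral over `I` and finitely generated, then `Jᴺ⁺¹ ⊆ I Jᴺ` for some `N`, that is, `I` is a
reduction of `J` (`Ideal.exists_pow_succ_le_mul_pow`). On `Y` the inverse image of `D J`, hence that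
of `J`, is invertible, and an invertible ideal may be cancelled from `Jᴺ⁺¹ ⊆ I Jᴺ`
(`Ideal.le_of_pow_succ_le_mul_pow`). So `I` and `J` have the same inverse image on `Y`
(`IsIntegralOver.pullbackEq`). On a quasi-compact scheme some finite product `P` of members of `Z`
clears the denominators of `J` (`IsFractionalFor.exists_forall_smul_sections_le_one`); the ideal
sheaf `T = P J` is then cosupported in the zero locus of `J` and in `P`, hence in `Z`, so that its
blow-up serves both for the condition relative to `Z` and for the blow-up along `J`.

*From blow-ups to integral dependence.* Properness of the blow-up and cohomology are avoided by
computing on the charts `A[T/t]` with `t ∈ T` (`blowupChart`). If a section `z` lies in `I A[T/t]`,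
then `z tⁿ ∈ I Tⁿ` for some `n`. As `T` is finitely generated, `z Tᴺ ⊆ I Tᴺ` for some `N`
(`Ideal.exists_pow_le_of_forall_exists_pow_mem`), and the determinant trick yields an equation of
integral dependence of `z` over `I` up to elements killed by a power of `T`
(`exists_integral_equation_of_mem_blowupChart`). If `T` is cosupported in effective Cartier
divisors, no section is killed by `T`, since the associated points of a locally Noetherian scheme
avoid effective Cartier divisors (`eq_zero_of_support_subset`). If `T = D J`, then what is killed by
a power of `T` is killed by a power of the numerator `z` of any element of `J`, and the equation is
multiplied by that power.

*Blow-ups.* A blow-up is characterised by its universal property. Its existence is proved by gluing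
the affine charts: a morphism `g` with `T 𝒪` effective Cartier factors through the chart of `t`,
uniquely, exactly when `t` generates `T 𝒪`, and locally some section of `T` is a generator
(`IsEffectiveCartier.exists_generator`, `exists_isBlowup`). An arbitrary blow-up maps
non-zero-divisors to non-zero-divisors, because it is an isomorphism outside of the exceptional
divisor (`IsBlowup.appLE_mem_nonZeroDivisors`), so inverse images of fractional ideals may be
computed on the ideals of their numerators (`numeratorIdeal_pullbackFractions`).
-/

noncomputable section

/-! ### Powers of ideals and integral dependence -/

/-- If `K` is a graded module of ideals over the Rees algebra of the finitely generated ideal `T`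
and every element of `T` has a power in the corresponding `K n`, then so does `T` itself. -/
theorem Ideal.exists_pow_le_of_forall_exists_pow_mem {A : Type*} [CommRing A] {T : Ideal A}
    (hT : T.FG) (K : ℕ → Ideal A) (hK : ∀ n, T * K n ≤ K (n + 1))
    (h : ∀ t ∈ T, ∃ n, t ^ n ∈ K n) : ∃ N, T ^ N ≤ K N := by
  have hK' : ∀ m n, T ^ m * K n ≤ K (m + n) := by
    intro m
    induction m with
    | zero => intro n; simp
    | succ m ih =>
      intro n
      rw [pow_succ, mul_assoc]
      refine (Ideal.mul_mono_right (hK n)).trans ((ih (n + 1)).trans ?_)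
      rw [add_assoc, add_comm 1 n]
  suffices H : ∀ S : Ideal A, S.FG → S ≤ T → ∃ N, S ^ N ≤ K N from H T hT le_rfl
  intro S hS
  refine Submodule.fg_induction (motive := fun S _ ↦ S ≤ T → ∃ N, S ^ N ≤ K N) ?_ ?_ S hS
  · intro x hx
    obtain ⟨n, hn⟩ := h x (hx (Submodule.mem_span_singleton_self x))
    refine ⟨n, ?_⟩
    change Ideal.span {x} ^ n ≤ _
    rwa [Ideal.span_singleton_pow, Ideal.span_singleton_le_iff_mem]
  · intro S₁ S₂ _ _ h₁ h₂ hle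
    have hle₁ : S₁ ≤ T := le_sup_left.trans hle
    have hle₂ : S₂ ≤ T := le_sup_right.trans hle
    obtain ⟨n₁, h₁⟩ := h₁ hle₁
    obtain ⟨n₂, h₂⟩ := h₂ hle₂
    refine ⟨n₁ + n₂, ?_⟩
    rw [← Submodule.add_eq_sup, add_pow, Ideal.sum_eq_sup]
    refine Finset.sup_le fun i hi ↦ Ideal.mul_le_left.trans ?_
    have hi' : i ≤ n₁ + n₂ := by simpa [Nat.lt_succ_iff] using hi
    -- In each term of the binomial expansion one of the two exponents is large.
    rcases le_total n₁ i with hni | hni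
    · calc S₁ ^ i * S₂ ^ (n₁ + n₂ - i) = (S₁ ^ (i - n₁) * S₂ ^ (n₁ + n₂ - i)) * S₁ ^ n₁ := by
            rw [mul_right_comm, ← pow_add, Nat.sub_add_cancel hni]
        _ ≤ (T ^ (i - n₁) * T ^ (n₁ + n₂ - i)) * K n₁ :=
            Ideal.mul_mono (Ideal.mul_mono (Ideal.pow_right_mono hle₁ _)
              (Ideal.pow_right_mono hle₂ _)) h₁
        _ = T ^ n₂ * K n₁ := by rw [← pow_add]; congr 2; omega
        _ ≤ K (n₁ + n₂) := by rw [add_comm]; exact hK' _ _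
    · calc S₁ ^ i * S₂ ^ (n₁ + n₂ - i) = (S₁ ^ i * S₂ ^ (n₁ - i)) * S₂ ^ n₂ := by
            rw [mul_assoc, ← pow_add]; congr 2; omega
        _ ≤ (T ^ i * T ^ (n₁ - i)) * K n₂ :=
            Ideal.mul_mono (Ideal.mul_mono (Ideal.pow_right_mono hle₁ _)
              (Ideal.pow_right_mono hle₂ _)) h₂
        _ = T ^ n₁ * K n₂ := by rw [← pow_add]; congr 2; omega
        _ ≤ K (n₁ + n₂) := hK' _ _

/-- An ideal is a reduction of every finitely generated ideal that is integral over it. -/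
theorem Ideal.exists_pow_succ_le_mul_pow {A : Type*} [CommRing A] {I J : Ideal A}
    (hJ : J.FG) (h : ∀ z ∈ J, ∃ n, z ^ (n + 1) ∈ I * J ^ n) : ∃ N, J ^ (N + 1) ≤ I * J ^ N := by
  have hK : ∀ n, J * (I * J ^ (n - 1)) ≤ I * J ^ (n + 1 - 1) := by
    intro n
    rw [mul_left_comm]
    cases n with
    | zero => exact Ideal.mul_mono_right (by simp)
    | succ n => simp [pow_succ']
  have hpow : ∀ z ∈ J, ∃ n, z ^ n ∈ I * J ^ (n - 1) := by
    intro z hz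
    obtain ⟨n, hn⟩ := h z hz
    exact ⟨n + 1, by simpa using hn⟩
  obtain ⟨N, hN⟩ := Ideal.exists_pow_le_of_forall_exists_pow_mem hJ _ hK hpow
  cases N with
  | zero =>
    have hN : ⊤ ≤ I := by simpa using hN
    exact ⟨0, by simpa using le_top.trans hN⟩
  | succ N => exact ⟨N, by simpa using hN⟩

/-- A reduction of an invertible ideal is equal to it. -/
theorem Ideal.le_of_pow_succ_le_mul_pow {A : Type*} [CommRing A] {I J E : Ideal A} {σ : A}
    (hσ : σ ∈ nonZeroDivisors A) (hE : E * J = Ideal.span {σ}) {N : ℕ}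
    (h : J ^ (N + 1) ≤ I * J ^ N) : J ≤ I := by
  have h₁ : Ideal.span {σ ^ N} * Ideal.span {σ} ≤ Ideal.span {σ ^ N} * (E * I) := by
    calc Ideal.span {σ ^ N} * Ideal.span {σ} = E ^ (N + 1) * J ^ (N + 1) := by
          rw [← Ideal.span_singleton_pow, ← pow_succ, ← hE, mul_pow]
      _ ≤ E ^ (N + 1) * (I * J ^ N) := Ideal.mul_mono_right h
      _ = Ideal.span {σ ^ N} * (E * I) := by
          rw [← Ideal.span_singleton_pow, ← hE, mul_pow, pow_succ]; ring
  have h₂ : σ ∈ E * I := by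
    have : σ ^ N * σ ∈ Ideal.span {σ ^ N} * (E * I) :=
      h₁ (Ideal.mul_mem_mul (Ideal.mem_span_singleton_self _) (Ideal.mem_span_singleton_self _))
    obtain ⟨z, hz, hz'⟩ := Ideal.mem_span_singleton_mul.mp this
    rwa [← (mul_cancel_left_mem_nonZeroDivisors (pow_mem hσ N)).mp hz']
  intro x hx
  have h₃ : σ * x ∈ Ideal.span {σ} * I := by
    rw [← hE, mul_right_comm]
    exact Ideal.mul_mem_mul h₂ hx
  obtain ⟨z, hz, hz'⟩ := Ideal.mem_span_singleton_mul.mp h₃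
  rwa [← (mul_cancel_left_mem_nonZeroDivisors hσ).mp hz']

theorem Ideal.eq_zero_of_forall_pow_mul_eq_zero {A : Type*} [CommRing A] {I : Ideal A}
    (hI : ∀ a : A, (∀ d ∈ I, d * a = 0) → a = 0) (n : ℕ) {a : A}
    (ha : ∀ d ∈ I ^ n, d * a = 0) : a = 0 := by
  induction n generalizing a with
  | zero => simpa using ha 1 (by simp)
  | succ n ih =>
    refine ih fun d hd ↦ hI _ fun e he ↦ ?_
    rw [← mul_assoc]
    exact ha _ (by rw [pow_succ']; exact Ideal.mul_mem_mul he hd)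

/-- An equation of integral dependence that holds after multiplication by a power of `z` gives one
of higher degree. -/
theorem exists_integral_equation_of_mul_pow {A : Type*} [CommRing A] {I : Ideal A} {z : A} {n : ℕ}
    {c : ℕ → A} (hn : 1 ≤ n) (hc : ∀ i ∈ Finset.Icc 1 n, c i ∈ I ^ i) (m : ℕ)
    (h : (z ^ n + ∑ i ∈ Finset.Icc 1 n, c i * z ^ (n - i)) * z ^ m = 0) :
    ∃ (n : ℕ) (c : ℕ → A), 1 ≤ n ∧ (∀ i ∈ Finset.Icc 1 n, c i ∈ I ^ i) ∧
      z ^ n + ∑ i ∈ Finset.Icc 1 n, c i * z ^ (n - i) = 0 := by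
  refine ⟨n + m, fun i ↦ if i ≤ n then c i else 0, by omega, fun i hi ↦ ?_, ?_⟩
  · dsimp only
    split_ifs with hin
    · exact hc i (Finset.mem_Icc.mpr ⟨(Finset.mem_Icc.mp hi).1, hin⟩)
    · exact zero_mem _
  · refine Eq.trans ?_ h
    rw [add_mul, ← pow_add, Finset.sum_mul]
    congr 1
    symm
    refine Finset.sum_subset_zero_on_sdiff (Finset.Icc_subset_Icc_right (by omega)) ?_ ?_
    · intro i hi
      rw [Finset.mem_sdiff, Finset.mem_Icc, Finset.mem_Icc] at hi
      dsimp only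
      rw [if_neg (by omega), zero_mul]
    · intro i hi
      have hin := (Finset.mem_Icc.mp hi).2
      dsimp only
      rw [if_pos hin, mul_assoc, ← pow_add]
      congr 2
      omega

open Polynomial in
/-- The determinant trick: if `z T ⊆ I T`, then an equation of integral dependence of `z` over `I`
holds after multiplication by `T`. -/
theorem Ideal.exists_integral_equation_of_mul_mem {A : Type*} [CommRing A] {I T : Ideal A}
    (hT : T.FG) {z : A} (h : ∀ x ∈ T, z * x ∈ I * T) :
    ∃ (n : ℕ) (c : ℕ → A), 1 ≤ n ∧ (∀ i ∈ Finset.Icc 1 n, c i ∈ I ^ i) ∧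
      ∀ x ∈ T, (z ^ n + ∑ i ∈ Finset.Icc 1 n, c i * z ^ (n - i)) * x = 0 := by
  have : Module.Finite A T := Module.Finite.iff_fg.mpr hT
  obtain ⟨p, hp, -, hc, hz⟩ :=
    LinearMap.exists_monic_and_natDegree_eq_and_coeff_mem_pow_and_aeval_eq_zero A
      (algebraMap A (Module.End A T) z) I (by
        rintro _ ⟨x, rfl⟩
        have e : I * T = (I • ⊤ : Submodule A T).map T.subtype := by
          rw [Submodule.map_smul'', Submodule.map_subtype_top, smul_eq_mul]
        have hx := h x x.2
        rw [e] at hx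
        obtain ⟨y, hy, hyx⟩ := hx
        have hy' : y = algebraMap A (Module.End A T) z x := Subtype.ext (by simpa using hyx)
        rwa [← hy'])
  rw [Polynomial.aeval_algebraMap_apply] at hz
  set d := p.natDegree with hd
  -- The polynomial is multiplied by the variable, so that its degree is positive.
  refine ⟨d + 1, fun i ↦ if i ≤ d then p.coeff (d - i) else 0, by omega, ?_, ?_⟩
  · intro i hi
    dsimp only
    split_ifs with hid
    · simpa [Nat.sub_sub_self hid] using hc (d - i)
    · exact zero_mem _
  · intro x hx
    have hx' : p.eval z * x = 0 := by
      simpa [Polynomial.aeval_def, Polynomial.eval₂_eq_eval_map] using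
        congr_arg Subtype.val (LinearMap.congr_fun hz ⟨x, hx⟩)
    suffices H : z ^ (d + 1) + ∑ i ∈ Finset.Icc 1 (d + 1),
        (if i ≤ d then p.coeff (d - i) else 0) * z ^ (d + 1 - i) = z * p.eval z by
      rw [H, mul_assoc, hx', mul_zero]
    have h₀ : z ^ (d + 1) = (if 0 ≤ d then p.coeff (d - 0) else 0) * z ^ (d + 1 - 0) := by
      simp [hd, hp.coeff_natDegree]
    have h₁ : Finset.Icc 1 (d + 1) = Finset.Ico 1 (d + 1 + 1) := rfl
    rw [h₁]
    nth_rw 1 [h₀]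
    rw [← Finset.sum_range_eq_add_Ico (fun i ↦
      (if i ≤ d then p.coeff (d - i) else 0) * z ^ (d + 1 - i)) (by omega),
      Finset.sum_range_succ, if_neg (by omega), zero_mul, add_zero, Polynomial.eval_eq_sum_range,
      ← hd, Finset.mul_sum, ← Finset.sum_range_reflect]
    refine Finset.sum_congr rfl fun i hi ↦ ?_
    have : i ≤ d := by simpa [Nat.lt_succ_iff] using hi
    rw [if_pos (by omega), show d - (d + 1 - 1 - i) = i by omega,
      show d + 1 - (d + 1 - 1 - i) = i + 1 by omega]
    ring

/-! ### Affine charts of blow-ups -/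

/-- The affine chart `A[T/t]` of the blow-up of the ideal `T`: the subalgebra of `A[1/t]` generated
by the fractions `x / t` with `x ∈ T`. -/
def blowupChart {A : Type u} [CommRing A] (T : Ideal A) (t : A) :
    Subalgebra A (Localization.Away t) :=
  Algebra.adjoin A
    {y | ∃ x ∈ T, algebraMap A (Localization.Away t) t * y = algebraMap A _ x}

namespace blowupChart

variable {A : Type u} [CommRing A] (T : Ideal A) (t : A)

theorem algebraMap_mem_nonZeroDivisors :
    algebraMap A (blowupChart T t) t ∈ nonZeroDivisors (blowupChart T t) := by
  rw [mem_nonZeroDivisors_iff_right]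
  intro x hx
  have h := congr_arg Subtype.val hx
  have hu : IsUnit (algebraMap A (Localization.Away t) t) :=
    IsLocalization.Away.algebraMap_isUnit t
  exact Subtype.ext (hu.mul_left_eq_zero.mp h)

theorem exists_eq_mul {x : A} (hx : x ∈ T) :
    ∃ y : blowupChart T t, algebraMap A _ x = algebraMap A _ t * y := by
  have hu : IsUnit (algebraMap A (Localization.Away t) t) :=
    IsLocalization.Away.algebraMap_isUnit t
  obtain ⟨u, hu⟩ := hu
  have h : algebraMap A (Localization.Away t) t * (↑u⁻¹ * algebraMap A _ x) = algebraMap A _ x := by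
    rw [← hu, Units.mul_inv_cancel_left]
  exact ⟨⟨_, Algebra.subset_adjoin ⟨x, hx, h⟩⟩, Subtype.ext h.symm⟩

theorem map_eq_span_singleton (ht : t ∈ T) :
    T.map (algebraMap A (blowupChart T t)) = Ideal.span {algebraMap A _ t} := by
  refine le_antisymm (Ideal.map_le_iff_le_comap.mpr fun x hx ↦ ?_) ?_
  · obtain ⟨y, hy⟩ := exists_eq_mul T t hx
    exact Ideal.mem_span_singleton.mpr ⟨y, hy⟩
  · rw [Ideal.span_singleton_le_iff_mem]
    exact Ideal.mem_map_of_mem _ ht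

/-- Two maps out of the chart that agree on the base ring are equal, provided that `t` becomes a
non-zero-divisor. -/
theorem hom_ext {C : Type*} [CommRing C] {f g : blowupChart T t →+* C}
    (h : f.comp (algebraMap A _) = g.comp (algebraMap A _))
    (ht : f (algebraMap A _ t) ∈ nonZeroDivisors C) : f = g := by
  have h' : ∀ a, f (algebraMap A _ a) = g (algebraMap A _ a) := fun a ↦ RingHom.congr_fun h a
  ext ⟨y, hy⟩
  induction hy using Algebra.adjoin_induction with
  | mem y hy =>
    obtain ⟨x, hx, hxy⟩ := hy
    set y' : blowupChart T t := ⟨y, Algebra.subset_adjoin ⟨x, hx, hxy⟩⟩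
    have e : algebraMap A (blowupChart T t) t * y' = algebraMap A _ x := Subtype.ext hxy
    rw [← mul_cancel_left_mem_nonZeroDivisors ht, ← map_mul, e, h' x, ← e, map_mul, h' t]
  | algebraMap a => exact h' a
  | add x y hx hy h₁ h₂ =>
    exact (map_add f ⟨x, hx⟩ ⟨y, hy⟩).trans ((congr_arg₂ _ h₁ h₂).trans (map_add g _ _).symm)
  | mul x y hx hy h₁ h₂ =>
    exact (map_mul f ⟨x, hx⟩ ⟨y, hy⟩).trans ((congr_arg₂ _ h₁ h₂).trans (map_mul g _ _).symm)

/-- The universal property of the chart. -/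
theorem exists_lift {C : Type*} [CommRing C] (φ : A →+* C) (ht : φ t ∈ nonZeroDivisors C)
    (hT : ∀ x ∈ T, φ t ∣ φ x) :
    ∃ ψ : blowupChart T t →+* C, ψ.comp (algebraMap A _) = φ := by
  let L := Localization.Away (φ t)
  have hinj : Function.Injective (algebraMap C L) :=
    IsLocalization.injective L (Submonoid.powers_le.mpr ht)
  let Φ : Localization.Away t →+* L := IsLocalization.Away.map _ L φ t
  have hΦ : ∀ a, Φ (algebraMap A _ a) = algebraMap C L (φ a) := fun a ↦
    IsLocalization.map_eq (S := Localization.Away t) (Q := L) _ a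
  have hrange : ∀ y : blowupChart T t, Φ y ∈ (algebraMap C L).range := by
    rintro ⟨y, hy⟩
    induction hy using Algebra.adjoin_induction with
    | mem y hy =>
      obtain ⟨x, hx, hxy⟩ := hy
      obtain ⟨c, hc⟩ := hT x hx
      refine ⟨c, ?_⟩
      have hu : IsUnit (algebraMap C L (φ t)) := IsLocalization.Away.algebraMap_isUnit _
      have hxy := congr_arg Φ hxy
      rw [map_mul, hΦ, hΦ, hc, map_mul] at hxy
      exact (hu.mul_right_inj.mp hxy).symm
    | algebraMap a => exact ⟨φ a, (hΦ a).symm⟩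
    | add x y hx hy h₁ h₂ =>
      have := add_mem h₁ h₂
      rwa [← map_add] at this
    | mul x y hx hy h₁ h₂ =>
      have := mul_mem h₁ h₂
      rwa [← map_mul] at this
  let e : C ≃+* (algebraMap C L).range :=
    RingEquiv.ofBijective (algebraMap C L).rangeRestrict
      ⟨fun a b h ↦ hinj (congr_arg Subtype.val h), (algebraMap C L).rangeRestrict_surjective⟩
  refine ⟨e.symm.toRingHom.comp ((Φ.comp (blowupChart T t).val.toRingHom).codRestrict _ hrange), ?_⟩
  ext a
  refine e.injective (Subtype.ext ?_)
  refine (congr_arg Subtype.val (e.apply_symm_apply _)).trans ?_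
  exact hΦ a

theorem exists_pow_mul_eq {t} (ht : t ∈ T) (b : blowupChart T t) :
    ∃ n, ∃ p ∈ T ^ n, algebraMap A (blowupChart T t) t ^ n * b = algebraMap A _ p := by
  obtain ⟨y, hy⟩ := b
  suffices H : ∃ n, ∃ p ∈ T ^ n, algebraMap A (Localization.Away t) t ^ n * y = algebraMap A _ p by
    obtain ⟨n, p, hp, h⟩ := H
    exact ⟨n, p, hp, Subtype.ext h⟩
  induction hy using Algebra.adjoin_induction with
  | mem y hy =>
    obtain ⟨x, hx, hxy⟩ := hy
    exact ⟨1, x, by simpa using hx, by simpa using hxy⟩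
  | algebraMap a => exact ⟨0, a, by simp, by simp⟩
  | add x y hx hy h₁ h₂ =>
    obtain ⟨n, p, hp, h₁⟩ := h₁
    obtain ⟨m, q, hq, h₂⟩ := h₂
    refine ⟨n + m, t ^ m * p + t ^ n * q, add_mem ?_ ?_, ?_⟩
    · rw [add_comm n m, pow_add]
      exact Ideal.mul_mem_mul (Ideal.pow_mem_pow ht m) hp
    · rw [pow_add]
      exact Ideal.mul_mem_mul (Ideal.pow_mem_pow ht n) hq
    · simp only [map_add, map_mul, map_pow, ← h₁, ← h₂]
      ring
  | mul x y hx hy h₁ h₂ =>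
    obtain ⟨n, p, hp, h₁⟩ := h₁
    obtain ⟨m, q, hq, h₂⟩ := h₂
    refine ⟨n + m, p * q, ?_, ?_⟩
    · rw [pow_add]
      exact Ideal.mul_mem_mul hp hq
    · simp only [map_mul, ← h₁, ← h₂]
      ring

/-- An element of `A` that lies in `I` on the chart `A[T/t]` is conducted into `I Tⁿ` by some power
`tⁿ`. -/
theorem exists_pow_mul_mem {t} (ht : t ∈ T) (I : Ideal A) {z : A}
    (hz : algebraMap A (blowupChart T t) z ∈ I.map (algebraMap A (blowupChart T t))) :
    ∃ n, z * t ^ n ∈ I * T ^ n := by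
  have key : ∀ y ∈ I.map (algebraMap A (blowupChart T t)), ∃ n, ∃ p ∈ I * T ^ n,
      algebraMap A (blowupChart T t) t ^ n * y = algebraMap A _ p := by
    intro y hy
    induction hy using Submodule.span_induction with
    | mem y hy =>
      obtain ⟨a, ha, rfl⟩ := hy
      exact ⟨0, a, by simpa using ha, by simp⟩
    | zero => exact ⟨0, 0, zero_mem _, by simp⟩
    | add x y hx hy h₁ h₂ =>
      obtain ⟨n, p, hp, h₁⟩ := h₁
      obtain ⟨m, q, hq, h₂⟩ := h₂
      refine ⟨n + m, t ^ m * p + t ^ n * q, add_mem ?_ ?_, ?_⟩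
      · rw [add_comm n m, pow_add, mul_left_comm]
        exact Ideal.mul_mem_mul (Ideal.pow_mem_pow ht m) hp
      · rw [pow_add, mul_left_comm]
        exact Ideal.mul_mem_mul (Ideal.pow_mem_pow ht n) hq
      · simp only [map_add, map_mul, map_pow, ← h₁, ← h₂]
        ring
    | smul b y hy h₁ =>
      obtain ⟨n, p, hp, h₁⟩ := h₁
      obtain ⟨m, q, hq, h₂⟩ := exists_pow_mul_eq T ht b
      refine ⟨n + m, p * q, ?_, ?_⟩
      · rw [pow_add, ← mul_assoc]
        exact Ideal.mul_mem_mul hp hq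
      · simp only [map_mul, ← h₁, ← h₂, smul_eq_mul]
        ring
  obtain ⟨n, p, hp, h⟩ := key _ hz
  have h' : algebraMap A (Localization.Away t) (t ^ n * z) = algebraMap A _ p := by
    simpa using congr_arg Subtype.val h
  obtain ⟨⟨_, k, rfl⟩, hk⟩ :=
    (IsLocalization.eq_iff_exists (Submonoid.powers t) (Localization.Away t)).mp h'
  refine ⟨k + n, ?_⟩
  have : z * t ^ (k + n) = t ^ k * p := by
    rw [← hk, pow_add]
    ring
  rw [this, pow_add, mul_left_comm]
  exact Ideal.mul_mem_mul (Ideal.pow_mem_pow ht k) hp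

end blowupChart

/-- Suppose that `z` lies in `I` on each of the charts `A[T/t]` of the blow-up of `T`. Then an
equation of integral dependence of `z` over `I` holds up to elements killed by a power of `T`. -/
theorem exists_integral_equation_of_mem_blowupChart {A : Type u} [CommRing A] {I T : Ideal A}
    (hT : T.FG) {z : A} (h : ∀ t ∈ T,
      algebraMap A (blowupChart T t) z ∈ I.map (algebraMap A (blowupChart T t))) :
    ∃ (N n : ℕ) (c : ℕ → A), 1 ≤ n ∧ (∀ i ∈ Finset.Icc 1 n, c i ∈ I ^ i) ∧
      ∀ x ∈ T ^ N, (z ^ n + ∑ i ∈ Finset.Icc 1 n, c i * z ^ (n - i)) * x = 0 := by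
  have hK : ∀ n, T * Submodule.comap (LinearMap.mulLeft A z) (I * T ^ n) ≤
      Submodule.comap (LinearMap.mulLeft A z) (I * T ^ (n + 1)) := by
    intro n
    rw [Ideal.mul_le]
    intro t ht x hx
    have hx : z * x ∈ I * T ^ n := hx
    change z * (t * x) ∈ I * T ^ (n + 1)
    rw [mul_left_comm, pow_succ', mul_left_comm]
    exact Ideal.mul_mem_mul ht hx
  obtain ⟨N, hN⟩ := Ideal.exists_pow_le_of_forall_exists_pow_mem hT
    (fun n ↦ Submodule.comap (LinearMap.mulLeft A z) (I * T ^ n)) hK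
    (fun t ht ↦ blowupChart.exists_pow_mul_mem T ht I (h t ht))
  exact ⟨N, Ideal.exists_integral_equation_of_mul_mem hT.pow hN⟩

/-! ### Numerators of fractional ideals -/

section Numerators

variable {A : Type u} [CommRing A]

/-- The ideal `s N` of numerators of the elements of `N` with respect to the denominator `s`. It
determines `N` if `s` is a non-zero-divisor that clears all denominators. -/
def numeratorIdeal (s : A) (N : Submodule A (FractionRing A)) : Ideal A :=
  (N.map (LinearMap.lsmul A (FractionRing A) s)).comap (Algebra.linearMap A (FractionRing A))

theorem mem_numeratorIdeal {s : A} {N : Submodule A (FractionRing A)} {a : A} :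
    a ∈ numeratorIdeal s N ↔ ∃ x ∈ N, s • x = algebraMap A (FractionRing A) a :=
  Iff.rfl

theorem numeratorIdeal_mono (s : A) {N M : Submodule A (FractionRing A)} (h : N ≤ M) :
    numeratorIdeal s N ≤ numeratorIdeal s M :=
  Submodule.comap_mono (Submodule.map_mono h)

theorem smul_right_injective_fractionRing {s : A} (hs : s ∈ nonZeroDivisors A)
    {x y : FractionRing A} (h : s • x = s • y) : x = y := by
  rw [Algebra.smul_def, Algebra.smul_def] at h
  exact (IsLocalization.map_units (FractionRing A) (⟨s, hs⟩ : nonZeroDivisors A)).mul_right_inj.mp h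

theorem eq_of_numeratorIdeal_eq {s : A} (hs : s ∈ nonZeroDivisors A)
    {N M : Submodule A (FractionRing A)} (hN : ∀ x ∈ N, IsLocalization.IsInteger A (s • x))
    (hM : ∀ x ∈ M, IsLocalization.IsInteger A (s • x))
    (h : numeratorIdeal s N = numeratorIdeal s M) : N = M := by
  have key : ∀ {N M : Submodule A (FractionRing A)}
      (_ : ∀ x ∈ N, IsLocalization.IsInteger A (s • x)),
      numeratorIdeal s N ≤ numeratorIdeal s M → N ≤ M := by
    intro N M hN h x hx
    obtain ⟨a, ha⟩ := hN x hx
    obtain ⟨y, hy, hya⟩ := h (mem_numeratorIdeal.mpr ⟨x, hx, ha.symm⟩)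
    rwa [← smul_right_injective_fractionRing hs (hya.trans ha)]
  exact le_antisymm (key hN h.le) (key hM h.ge)

theorem exists_isInteger_smul {N : Submodule A (FractionRing A)} (hN : N.FG) :
    ∃ s ∈ nonZeroDivisors A, ∀ x ∈ N, IsLocalization.IsInteger A (s • x) :=
  FractionalIdeal.isFractional_of_fg hN

theorem numeratorIdeal_fg {s : A} {N : Submodule A (FractionRing A)}
    (hN : N.FG) (hsN : ∀ x ∈ N, IsLocalization.IsInteger A (s • x)) :
    (numeratorIdeal s N).FG := by
  have h : Submodule.map (Algebra.linearMap A (FractionRing A)) (numeratorIdeal s N) =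
      N.map (LinearMap.lsmul A (FractionRing A) s) := by
    refine Submodule.map_comap_eq_self ?_
    rintro _ ⟨x, hx, rfl⟩
    exact hsN x hx
  refine Submodule.fg_of_fg_map_injective (Algebra.linearMap A (FractionRing A))
    (IsFractionRing.injective A (FractionRing A)) ?_
  rw [h]
  exact hN.map _

/-- Numerators commute with inverse images. -/
theorem numeratorIdeal_pullbackFractions {B : Type u} [CommRing B] (φ : A →+* B)
    (hφ : ∀ s ∈ nonZeroDivisors A, φ s ∈ nonZeroDivisors B) {s : A} (hs : s ∈ nonZeroDivisors A)
    {N : Submodule A (FractionRing A)} (hN : ∀ x ∈ N, IsLocalization.IsInteger A (s • x)) :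
    numeratorIdeal (φ s) (pullbackFractions φ N) = (numeratorIdeal s N).map φ ∧
      ∀ y ∈ pullbackFractions φ N, IsLocalization.IsInteger B (φ s • y) := by
  have key : ∀ y ∈ pullbackFractions φ N, ∃ b ∈ (numeratorIdeal s N).map φ,
      algebraMap B (FractionRing B) b = φ s • y := by
    intro y hy
    induction hy using Submodule.span_induction with
    | mem y hy =>
      obtain ⟨a, r, hr, hr', hx, rfl⟩ := hy
      obtain ⟨n, hn⟩ := hN _ hx
      refine ⟨φ n, Ideal.mem_map_of_mem _ (mem_numeratorIdeal.mpr ⟨_, hx, hn.symm⟩), ?_⟩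
      have h : r * n = s * a := by
        apply IsFractionRing.injective A (FractionRing A)
        rw [map_mul, hn, Algebra.smul_def, map_mul, mul_left_comm]
        congr 1
        exact IsLocalization.mk'_spec' (FractionRing A) a (⟨r, hr⟩ : nonZeroDivisors A)
      apply smul_right_injective_fractionRing hr'
      rw [Algebra.smul_def, ← map_mul, ← map_mul, h, smul_comm, Algebra.smul_def (φ r),
        IsLocalization.mk'_spec'_mk, Algebra.smul_def, ← map_mul, map_mul φ]
    | zero => exact ⟨0, zero_mem _, by simp⟩
    | add x y _ _ h₁ h₂ =>
      obtain ⟨a, ha, h₁⟩ := h₁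
      obtain ⟨b, hb, h₂⟩ := h₂
      exact ⟨a + b, add_mem ha hb, by rw [map_add, h₁, h₂, smul_add]⟩
    | smul c y _ h₁ =>
      obtain ⟨a, ha, h₁⟩ := h₁
      exact ⟨c * a, Ideal.mul_mem_left _ _ ha, by
        rw [map_mul, h₁, smul_comm, Algebra.smul_def c]⟩
  refine ⟨le_antisymm ?_ (Ideal.map_le_iff_le_comap.mpr ?_), fun y hy ↦ ?_⟩
  · rintro b ⟨y, hy, hyb⟩
    obtain ⟨b', hb', h⟩ := key y hy
    have : b' = b := IsFractionRing.injective B (FractionRing B) (h.trans hyb)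
    rwa [← this]
  · rintro a ⟨x, hx, hxa⟩
    refine mem_numeratorIdeal.mpr ⟨_, Submodule.subset_span ⟨a, s, hs, hφ s hs, ?_, rfl⟩, ?_⟩
    · have : IsLocalization.mk' (FractionRing A) a ⟨s, hs⟩ = x := by
        rw [IsLocalization.mk'_eq_iff_eq_mul]
        refine hxa.symm.trans ?_
        rw [mul_comm]
        exact Algebra.smul_def _ _
      rwa [this]
    · exact (Algebra.smul_def _ _).trans
        (IsLocalization.mk'_spec' (FractionRing B) (φ a) (⟨φ s, hφ s hs⟩ : nonZeroDivisors B))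
  · obtain ⟨b, -, h⟩ := key y hy
    exact ⟨b, h⟩

theorem exists_mem_numeratorIdeal_pow {s : A} {N : Submodule A (FractionRing A)}
    (hN : ∀ x ∈ N, IsLocalization.IsInteger A (s • x)) (i : ℕ) {x : FractionRing A}
    (hx : x ∈ N ^ i) :
    ∃ a ∈ numeratorIdeal s N ^ i, algebraMap A (FractionRing A) a = s ^ i • x := by
  induction i generalizing x with
  | zero =>
    rw [pow_zero, Submodule.mem_one] at hx
    obtain ⟨a, rfl⟩ := hx
    exact ⟨a, by simp, by simp⟩
  | succ i ih =>
    rw [pow_succ] at hx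
    induction hx using Submodule.mul_induction_on' with
    | mem_mul_mem x hx y hy =>
      obtain ⟨a, ha, h₁⟩ := ih hx
      obtain ⟨b, h₂⟩ := hN y hy
      refine ⟨a * b, ?_, ?_⟩
      · rw [pow_succ]
        exact Ideal.mul_mem_mul ha (mem_numeratorIdeal.mpr ⟨y, hy, h₂.symm⟩)
      · rw [map_mul, h₁, h₂, smul_mul_smul_comm, ← pow_succ]
    | add x _ y _ h₁ h₂ =>
      obtain ⟨a, ha, h₁⟩ := h₁
      obtain ⟨b, hb, h₂⟩ := h₂
      exact ⟨a + b, add_mem ha hb, by rw [map_add, h₁, h₂, smul_add]⟩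

theorem exists_smul_eq_of_mem_numeratorIdeal_pow {s : A} {N : Submodule A (FractionRing A)}
    (i : ℕ) {a : A} (ha : a ∈ numeratorIdeal s N ^ i) :
    ∃ x ∈ N ^ i, s ^ i • x = algebraMap A (FractionRing A) a := by
  induction i generalizing a with
  | zero => exact ⟨algebraMap A _ a, by rw [pow_zero]; exact Submodule.algebraMap_mem a, by simp⟩
  | succ i ih =>
    rw [pow_succ] at ha
    induction ha using Submodule.mul_induction_on' with
    | mem_mul_mem a ha b hb =>
      obtain ⟨x, hx, h₁⟩ := ih ha
      obtain ⟨y, hy, h₂⟩ := mem_numeratorIdeal.mp hb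
      refine ⟨x * y, ?_, ?_⟩
      · rw [pow_succ]
        exact Submodule.mul_mem_mul hx hy
      · rw [map_mul, ← h₁, ← h₂, smul_mul_smul_comm, ← pow_succ]
    | add a _ b _ h₁ h₂ =>
      obtain ⟨x, hx, h₁⟩ := h₁
      obtain ⟨y, hy, h₂⟩ := h₂
      exact ⟨x + y, add_mem hx hy, by rw [map_add, ← h₁, ← h₂, smul_add]⟩

/-- The relation `T = D N` between an ideal and a fractional ideal, in terms of numerators. -/
theorem span_singleton_mul_eq_mul_numeratorIdeal {s : A} {N : Submodule A (FractionRing A)}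
    (hN : ∀ x ∈ N, IsLocalization.IsInteger A (s • x)) {D T : Ideal A}
    (h : IsLocalization.coeSubmodule (FractionRing A) T = D • N) :
    Ideal.span {s} * T = D * numeratorIdeal s N := by
  have hinj := IsFractionRing.injective A (FractionRing A)
  refine le_antisymm (Ideal.span_singleton_mul_le_iff.mpr fun t ht ↦ ?_)
    (Ideal.mul_le.mpr fun d hd a ha ↦ ?_)
  · have key : ∀ y ∈ D • N, ∃ p ∈ D * numeratorIdeal s N,
        algebraMap A (FractionRing A) p = s • y := by
      intro y hy
      induction hy using Submodule.smul_induction_on' with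
      | smul d hd x hx =>
        obtain ⟨a, ha⟩ := hN x hx
        refine ⟨d * a, Ideal.mul_mem_mul hd (mem_numeratorIdeal.mpr ⟨x, hx, ha.symm⟩), ?_⟩
        rw [map_mul, ha, smul_comm, Algebra.smul_def d]
      | add x _ y _ h₁ h₂ =>
        obtain ⟨a, ha, h₁⟩ := h₁
        obtain ⟨b, hb, h₂⟩ := h₂
        exact ⟨a + b, add_mem ha hb, by rw [map_add, h₁, h₂, smul_add]⟩
    obtain ⟨p, hp, hpt⟩ := key (algebraMap A (FractionRing A) t)
      (h ▸ (IsLocalization.mem_coeSubmodule _ _).mpr ⟨t, ht, rfl⟩)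
    rw [Algebra.smul_def, ← map_mul] at hpt
    rwa [← hinj hpt]
  · obtain ⟨x, hx, hxa⟩ := mem_numeratorIdeal.mp ha
    obtain ⟨t, ht, htx⟩ := (IsLocalization.mem_coeSubmodule _ _).mp
      (h ▸ Submodule.smul_mem_smul hd hx)
    have : d * a = s * t := by
      apply hinj
      rw [map_mul, ← hxa, map_mul, htx, Algebra.smul_def, Algebra.smul_def, mul_left_comm]
    rw [this]
    exact Ideal.mul_mem_mul (Ideal.mem_span_singleton_self s) ht

/-- An equation of integral dependence between fractional ideals gives a power of the numerator
that lies in the product required of a reduction. -/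
theorem exists_pow_succ_mem_of_integral_equation {s : A}
    {N M : Submodule A (FractionRing A)} (hNM : N ≤ M)
    (hM : ∀ x ∈ M, IsLocalization.IsInteger A (s • x)) {a : A} {z : FractionRing A} (hz : z ∈ M)
    (ha : s • z = algebraMap A (FractionRing A) a)
    (h : ∃ (n : ℕ) (c : ℕ → FractionRing A), 1 ≤ n ∧ (∀ i ∈ Finset.Icc 1 n, c i ∈ N ^ i) ∧
      z ^ n + ∑ i ∈ Finset.Icc 1 n, c i * z ^ (n - i) = 0) :
    ∃ n, a ^ (n + 1) ∈ numeratorIdeal s N * numeratorIdeal s M ^ n := by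
  obtain ⟨n, c, hn, hc, h⟩ := h
  have hN : ∀ x ∈ N, IsLocalization.IsInteger A (s • x) := fun x hx ↦ hM x (hNM hx)
  have haM : a ∈ numeratorIdeal s M := mem_numeratorIdeal.mpr ⟨z, hz, ha⟩
  choose! d hd hd' using fun i (hi : i ∈ Finset.Icc 1 n) ↦
    exists_mem_numeratorIdeal_pow hN i (hc i hi)
  have key : a ^ n + ∑ i ∈ Finset.Icc 1 n, d i * a ^ (n - i) = 0 := by
    apply IsFractionRing.injective A (FractionRing A)
    rw [map_add, map_zero, map_sum, map_pow, ← ha, smul_pow,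
      ← smul_zero (A := FractionRing A) (s ^ n), ← h, smul_add, Finset.smul_sum]
    congr 1
    refine Finset.sum_congr rfl fun i hi ↦ ?_
    rw [map_mul, hd' i hi, map_pow, ← ha, smul_pow, smul_mul_smul_comm, ← pow_add,
      Nat.add_sub_cancel' (Finset.mem_Icc.mp hi).2]
  refine ⟨n - 1, ?_⟩
  rw [Nat.sub_add_cancel hn, eq_neg_of_add_eq_zero_left key]
  refine neg_mem (sum_mem fun i hi ↦ ?_)
  have hi' := Finset.mem_Icc.mp hi
  have h₁ : numeratorIdeal s N ^ i * numeratorIdeal s M ^ (n - i) ≤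
      numeratorIdeal s N * numeratorIdeal s M ^ (n - 1) := by
    obtain ⟨j, rfl⟩ : ∃ j, i = j + 1 := ⟨i - 1, by omega⟩
    rw [pow_succ', mul_assoc]
    refine Ideal.mul_mono_right ((Ideal.mul_mono_left
      (Ideal.pow_right_mono (numeratorIdeal_mono s hNM) j)).trans ?_)
    rw [← pow_add]
    exact (congr_arg _ (by omega)).le
  exact h₁ (Ideal.mul_mem_mul (hd i hi) (Ideal.pow_mem_pow haM _))

/-- An equation of integral dependence between numerators gives one between fractions. -/
theorem integral_equation_of_numerators {s : A} (hs : s ∈ nonZeroDivisors A)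
    {N : Submodule A (FractionRing A)} {a : A} {z : FractionRing A}
    (ha : s • z = algebraMap A (FractionRing A) a)
    (h : ∃ (n : ℕ) (c : ℕ → A), 1 ≤ n ∧ (∀ i ∈ Finset.Icc 1 n, c i ∈ numeratorIdeal s N ^ i) ∧
      a ^ n + ∑ i ∈ Finset.Icc 1 n, c i * a ^ (n - i) = 0) :
    ∃ (n : ℕ) (c : ℕ → FractionRing A), 1 ≤ n ∧ (∀ i ∈ Finset.Icc 1 n, c i ∈ N ^ i) ∧
      z ^ n + ∑ i ∈ Finset.Icc 1 n, c i * z ^ (n - i) = 0 := by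
  obtain ⟨n, c, hn, hc, h⟩ := h
  choose! d hd hd' using fun i (hi : i ∈ Finset.Icc 1 n) ↦
    exists_smul_eq_of_mem_numeratorIdeal_pow i (hc i hi)
  refine ⟨n, d, hn, hd, ?_⟩
  apply smul_right_injective_fractionRing (pow_mem hs n)
  rw [smul_zero, ← map_zero (algebraMap A (FractionRing A)), ← h, smul_add, Finset.smul_sum,
    map_add, map_sum, map_pow, ← ha, smul_pow]
  congr 1
  refine Finset.sum_congr rfl fun i hi ↦ ?_
  rw [map_mul, ← hd' i hi, map_pow, ← ha, smul_pow, smul_mul_smul_comm, ← pow_add,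
    Nat.add_sub_cancel' (Finset.mem_Icc.mp hi).2]

end Numerators

/-! ### Inverse images of ideal sheaves -/

namespace AlgebraicGeometry.Scheme.IdealSheafData

variable {X Y : Scheme.{u}}

theorem ideal_comap_of_isOpenImmersion_of_le (E : X.IdealSheafData) (f : Y ⟶ X)
    [IsOpenImmersion f] (V : X.affineOpens) (W : Y.affineOpens) (h : W.1 ≤ f ⁻¹ᵁ V.1) :
    (E.comap f).ideal W = (E.ideal V).map (f.appLE V.1 W.1 h).hom := by
  have hWV : f ''ᵁ W.1 ≤ V.1 := (f.image_mono h).trans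
    (f.image_preimage_eq_opensRange_inf V.1 ▸ inf_le_right)
  have e : E.ideal ⟨f ''ᵁ W.1, W.2.image_of_isOpenImmersion f⟩ =
      ((E.ideal V).map (f.appLE V.1 W.1 h).hom).map (f.appIso W.1).inv.hom := by
    rw [Ideal.map_map, ← CommRingCat.hom_comp, f.appLE_appIso_inv h]
    exact (E.map_ideal (U := ⟨f ''ᵁ W.1, W.2.image_of_isOpenImmersion f⟩) (V := V) hWV).symm
  rw [ideal_comap_of_isOpenImmersion, e]
  exact Ideal.comap_map_of_bijective _ (ConcreteCategory.bijective_of_isIso (f.appIso W.1).inv)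

theorem ideal_comap_top_of_isAffine [IsAffine X] [IsAffine Y] (E : X.IdealSheafData) (f : Y ⟶ X) :
    (E.comap f).ideal ⟨⊤, isAffineOpen_top Y⟩ =
      (E.ideal ⟨⊤, isAffineOpen_top X⟩).map f.appTop.hom := by
  refine le_antisymm ?_ (Ideal.map_le_iff_le_comap.mpr ?_)
  · have h : E.comap f ≤
        ofIdealTop ((E.ideal ⟨⊤, isAffineOpen_top X⟩).map f.appTop.hom) := by
      rw [← le_map_iff_comap_le]
      refine le_of_isAffine ?_
      rw [ideal_map_of_isAffineHom]
      refine Ideal.map_le_iff_le_comap.mp ?_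
      have := (equivOfIsAffine (X := Y)).apply_symm_apply
        ((E.ideal ⟨⊤, isAffineOpen_top X⟩).map f.appTop.hom)
      exact this.ge
    refine (h ⟨⊤, isAffineOpen_top Y⟩).trans ?_
    exact ((equivOfIsAffine (X := Y)).apply_symm_apply _).le
  · have h := E.le_map_comap f ⟨⊤, isAffineOpen_top X⟩
    rwa [ideal_map_of_isAffineHom] at h

/-- On affine opens, the inverse image of an ideal sheaf is the extension of ideals. -/
theorem ideal_comap (E : X.IdealSheafData) (f : Y ⟶ X)
    (V : X.affineOpens) (W : Y.affineOpens) (h : W.1 ≤ f ⁻¹ᵁ V.1) :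
    (E.comap f).ideal W = (E.ideal V).map (f.appLE V.1 W.1 h).hom := by
  have : IsAffine V.1 := V.2
  have : IsAffine W.1 := W.2
  have hV : (⊤ : V.1.toScheme.Opens) ≤ V.1.ι ⁻¹ᵁ V.1 := by simp
  have hW : (⊤ : W.1.toScheme.Opens) ≤ W.1.ι ⁻¹ᵁ W.1 := by simp
  have h₁ := (E.comap f).ideal_comap_of_isOpenImmersion_of_le W.1.ι W ⟨⊤, isAffineOpen_top _⟩ hW
  have h₂ := E.ideal_comap_of_isOpenImmersion_of_le V.1.ι V ⟨⊤, isAffineOpen_top _⟩ hV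
  have h₃ := (E.comap V.1.ι).ideal_comap_top_of_isAffine (f.resLE V.1 W.1 h)
  rw [← comap_comp, ← Hom.resLE_comp_ι f h, comap_comp, h₃, h₂, Ideal.map_map,
    ← CommRingCat.hom_comp] at h₁
  have e : V.1.ι.appLE V.1 ⊤ hV ≫ (f.resLE V.1 W.1 h).appTop =
      f.appLE V.1 W.1 h ≫ W.1.ι.appLE W.1 ⊤ hW := by
    have hle : (⊤ : W.1.toScheme.Opens) ≤ f.resLE V.1 W.1 h ⁻¹ᵁ ⊤ := by simp
    have e₁ : (f.resLE V.1 W.1 h).appTop = (f.resLE V.1 W.1 h).appLE ⊤ ⊤ hle :=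
      Hom.app_eq_appLE _
    rw [e₁, Hom.appLE_comp_appLE, Hom.appLE_comp_appLE]
    simp only [Hom.resLE_comp_ι]
  rw [e, CommRingCat.hom_comp, ← Ideal.map_map] at h₁
  -- The restriction of sections to `W` as a scheme has a left inverse.
  let r := (W.1.ι.appIso ⊤).inv ≫ Y.presheaf.map (homOfLE (W.1.ι_image_top).ge).op
  have hr : W.1.ι.appLE W.1 ⊤ hW ≫ r = 𝟙 _ := by
    rw [Hom.appLE_appIso_inv_assoc, ← Functor.map_comp]
    exact Y.presheaf.map_id _
  have hr' : ∀ K : Ideal Γ(Y, W.1), (K.map (W.1.ι.appLE W.1 ⊤ hW).hom).map r.hom = K := by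
    intro K
    rw [Ideal.map_map, ← CommRingCat.hom_comp, hr, CommRingCat.hom_id, Ideal.map_id]
  exact (hr' _).symm.trans ((congr_arg (Ideal.map r.hom) h₁).symm.trans (hr' _))

end AlgebraicGeometry.Scheme.IdealSheafData

/-! ### Non-zero-divisors and effective Cartier divisors -/

theorem RingHom.Flat.map_mem_nonZeroDivisors {A B : Type*} [CommRing A] [CommRing B] {φ : A →+* B}
    (hφ : φ.Flat) {s : A} (hs : s ∈ nonZeroDivisors A) : φ s ∈ nonZeroDivisors B := by
  algebraize [φ]
  rw [mem_nonZeroDivisors_iff_left]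
  intro x hx
  refine Module.Flat.isSMulRegular_of_nonZeroDivisors (M := B) hs ?_
  change s • x = s • (0 : B)
  rw [smul_zero, Algebra.smul_def]
  exact hx

namespace AlgebraicGeometry.Scheme

variable {X Y : Scheme.{u}}

theorem Hom.appLE_mem_nonZeroDivisors (f : Y ⟶ X) [Flat f] (V : X.affineOpens) (W : Y.affineOpens)
    (h : W.1 ≤ f ⁻¹ᵁ V.1) {s : Γ(X, V.1)} (hs : s ∈ nonZeroDivisors Γ(X, V.1)) :
    f.appLE V.1 W.1 h s ∈ nonZeroDivisors Γ(Y, W.1) :=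
  (HasRingHomProperty.appLE @Flat f inferInstance V W h).map_mem_nonZeroDivisors hs

theorem map_mem_nonZeroDivisors {V W : X.affineOpens} (h : W.1 ≤ V.1) {s : Γ(X, V.1)}
    (hs : s ∈ nonZeroDivisors Γ(X, V.1)) :
    X.presheaf.map (homOfLE h).op s ∈ nonZeroDivisors Γ(X, W.1) := by
  have := Hom.appLE_mem_nonZeroDivisors (𝟙 X) V W h hs
  rwa [show (𝟙 X : X ⟶ X).appLE V.1 W.1 h = X.presheaf.map (homOfLE h).op from
    Category.id_comp _] at this

theorem exists_affineOpens_le {U : X.Opens} {x : X} (hx : x ∈ U) :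
    ∃ W : X.affineOpens, x ∈ W.1 ∧ W.1 ≤ U := by
  obtain ⟨_, ⟨W, hW, rfl⟩, hxW, hWU⟩ := X.isBasis_affineOpens.exists_subset_of_mem_open hx U.2
  exact ⟨⟨W, hW⟩, hxW, hWU⟩

/-- Equality of sections can be tested on affine neighbourhoods of the points. -/
theorem section_ext {U : X.Opens} {a b : Γ(X, U)}
    (h : ∀ x ∈ U, ∃ (W : X.affineOpens) (hW : W.1 ≤ U), x ∈ W.1 ∧
      X.presheaf.map (homOfLE hW).op a = X.presheaf.map (homOfLE hW).op b) : a = b := by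
  refine TopCat.Presheaf.section_ext X.sheaf U a b fun x hx ↦ ?_
  obtain ⟨W, hW, hxW, e⟩ := h x hx
  have := congr_arg (X.presheaf.germ W.1 x hxW) e
  rwa [TopCat.Presheaf.germ_res_apply, TopCat.Presheaf.germ_res_apply] at this

/-- An inclusion of ideals can be tested on affine neighbourhoods of the points. -/
theorem ideal_le_of_forall_exists {V : X.affineOpens} {I J : Ideal Γ(X, V.1)}
    (h : ∀ x ∈ V.1, ∃ (W : X.affineOpens) (hW : W.1 ≤ V.1), x ∈ W.1 ∧
      I.map (X.presheaf.map (homOfLE hW).op).hom ≤ J.map (X.presheaf.map (homOfLE hW).op).hom) :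
    I ≤ J := by
  rw [V.2.ideal_le_iff]
  intro x hx
  obtain ⟨W, hW, hxW, e⟩ := h x hx
  have := Ideal.map_mono (f := (X.presheaf.germ W.1 x hxW).hom) e
  rwa [Ideal.map_map, Ideal.map_map, ← CommRingCat.hom_comp, TopCat.Presheaf.germ_res] at this

end AlgebraicGeometry.Scheme

namespace IsEffectiveCartier

variable {X Y : Scheme.{u}} {D E : X.IdealSheafData}

theorem exists_le (hD : IsEffectiveCartier D) {U : X.Opens} {x : X} (hx : x ∈ U) :
    ∃ W : X.affineOpens, x ∈ W.1 ∧ W.1 ≤ U ∧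
      ∃ s ∈ nonZeroDivisors Γ(X, W.1), D.ideal W = Ideal.span {s} := by
  obtain ⟨V, hxV, s, hs, h⟩ := hD x
  obtain ⟨W, hxW, hW⟩ := Scheme.exists_affineOpens_le (U := U ⊓ V.1) ⟨hx, hxV⟩
  refine ⟨W, hxW, hW.trans inf_le_left, _,
    Scheme.map_mem_nonZeroDivisors (hW.trans inf_le_right) hs, ?_⟩
  rw [← D.map_ideal (U := W) (V := V) (hW.trans inf_le_right), h, Ideal.map_span,
    Set.image_singleton]
  rfl

theorem eq_zero_of_forall_mul_eq_zero (hD : IsEffectiveCartier D) {V : X.affineOpens}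
    {a : Γ(X, V.1)} (ha : ∀ d ∈ D.ideal V, d * a = 0) : a = 0 := by
  refine Scheme.section_ext fun x hx ↦ ?_
  obtain ⟨W, hxW, hWV, s, hs, h⟩ := hD.exists_le hx
  refine ⟨W, hWV, hxW, ?_⟩
  have key : D.ideal W ≤
      Submodule.comap (LinearMap.mulRight Γ(X, W.1) (X.presheaf.map (homOfLE hWV).op a)) ⊥ := by
    rw [← D.map_ideal (U := W) (V := V) hWV]
    refine Ideal.span_le.mpr ?_
    rintro _ ⟨d, hd, rfl⟩
    change X.presheaf.map (homOfLE hWV).op d * X.presheaf.map (homOfLE hWV).op a = 0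
    rw [← map_mul, ha d hd, map_zero]
  rw [map_zero]
  have hs' : s ∈ D.ideal W := h ▸ Ideal.mem_span_singleton_self s
  exact (mul_left_mem_nonZeroDivisors_eq_zero_iff hs).mp (key hs')

theorem mem_nonZeroDivisors (hD : IsEffectiveCartier D) {V : X.affineOpens} {s : Γ(X, V.1)}
    (hs : D.ideal V = Ideal.span {s}) : s ∈ nonZeroDivisors Γ(X, V.1) := by
  rw [mem_nonZeroDivisors_iff_left]
  intro a ha
  refine hD.eq_zero_of_forall_mul_eq_zero fun d hd ↦ ?_
  obtain ⟨c, rfl⟩ := Ideal.mem_span_singleton'.mp (hs ▸ hd)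
  rw [mul_assoc, ha, mul_zero]

theorem comap_of_isOpenImmersion (hD : IsEffectiveCartier D) (f : Y ⟶ X) [IsOpenImmersion f] :
    IsEffectiveCartier (D.comap f) := by
  intro y
  obtain ⟨V, hxV, s, hs, h⟩ := hD (f y)
  obtain ⟨W, hyW, hW⟩ := Scheme.exists_affineOpens_le (U := f ⁻¹ᵁ V.1) hxV
  refine ⟨W, hyW, _, Scheme.Hom.appLE_mem_nonZeroDivisors f V W hW hs, ?_⟩
  rw [D.ideal_comap f V W hW, h, Ideal.map_span, Set.image_singleton]

/-- Being an effective Cartier divisor is local. -/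
theorem of_forall_exists
    (h : ∀ x : X, ∃ (U : Scheme.{u}) (f : U ⟶ X) (_ : IsOpenImmersion f),
      x ∈ Set.range f ∧ IsEffectiveCartier (D.comap f)) : IsEffectiveCartier D := by
  intro x
  obtain ⟨U, f, _, ⟨y, rfl⟩, hU⟩ := h x
  obtain ⟨W, hyW, s, hs, h⟩ := hU y
  refine ⟨⟨f ''ᵁ W.1, W.2.image_of_isOpenImmersion f⟩, ⟨y, hyW, rfl⟩, (f.appIso W.1).inv s, ?_, ?_⟩
  · exact (RingHom.Flat.of_bijective
      (ConcreteCategory.bijective_of_isIso (f.appIso W.1).inv)).map_mem_nonZeroDivisors hs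
  · rw [Scheme.IdealSheafData.ideal_comap_of_isOpenImmersion] at h
    have h' := congr_arg (Ideal.map (f.appIso W.1).inv.hom) h
    rw [Ideal.map_comap_of_surjective _
      (ConcreteCategory.bijective_of_isIso (f.appIso W.1).inv).surjective, Ideal.map_span,
      Set.image_singleton] at h'
    exact h'

theorem mul (hD : IsEffectiveCartier D) (hE : IsEffectiveCartier E) :
    IsEffectiveCartier (D * E) := by
  intro x
  obtain ⟨V, hxV, s, hs, h⟩ := hD x
  obtain ⟨W, hxW, hWV, t, ht, h'⟩ := hE.exists_le hxV
  refine ⟨W, hxW, _, mul_mem (Scheme.map_mem_nonZeroDivisors hWV hs) ht, ?_⟩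
  rw [Scheme.IdealSheafData.ideal_mul, Pi.mul_apply, h',
    ← D.map_ideal (U := W) (V := V) hWV, h, Ideal.map_span,
    Set.image_singleton, Ideal.span_singleton_mul_span_singleton]
  rfl

theorem top : IsEffectiveCartier (⊤ : X.IdealSheafData) := by
  intro x
  obtain ⟨V, hxV, -⟩ := Scheme.exists_affineOpens_le (U := ⊤) (x := x) trivial
  exact ⟨V, hxV, 1, one_mem _, by simp⟩

end IsEffectiveCartier

/-! ### Local generators of inverse image ideals -/

section GenLocus

variable {X Y W : Scheme.{u}}

/-- On the locus where `v` is invertible, `v * σ` generates the ideal generated by `σ`. -/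
theorem AlgebraicGeometry.Scheme.IdealSheafData.ideal_affineBasicOpen_eq_span_mul
    (E : Y.IdealSheafData) {W : Y.affineOpens} {σ : Γ(Y, W.1)} (h : E.ideal W = Ideal.span {σ})
    (v : Γ(Y, W.1)) :
    E.ideal (Y.affineBasicOpen v) =
      Ideal.span {Y.presheaf.map (homOfLE (Y.basicOpen_le v)).op (v * σ)} := by
  have hv : IsUnit (Y.presheaf.map (homOfLE (Y.basicOpen_le v)).op v) :=
    RingedSpace.isUnit_res_basicOpen _ v
  rw [map_mul, Ideal.span_singleton_mul_left_unit hv, ← E.map_ideal_basicOpen W v, h,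
    Ideal.map_span, Set.image_singleton]

/-- If the inverse image of `T` is an effective Cartier divisor, then it is locally generated by the
image of a single section of `T`. -/
theorem IsEffectiveCartier.exists_generator {T : X.IdealSheafData} {g : Y ⟶ X}
    (hg : IsEffectiveCartier (T.comap g)) (V : X.affineOpens) {U : Y.Opens} {y : Y} (hyU : y ∈ U)
    (hyV : g y ∈ V.1) :
    ∃ W : Y.affineOpens, y ∈ W.1 ∧ W.1 ≤ U ∧ ∃ h : W.1 ≤ g ⁻¹ᵁ V.1, ∃ t ∈ T.ideal V,
      (T.comap g).ideal W = Ideal.span {g.appLE V.1 W.1 h t} := by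
  obtain ⟨W, hyW, hW, σ, hσ, hT⟩ := hg.exists_le (U := U ⊓ g ⁻¹ᵁ V.1) (x := y) ⟨hyU, hyV⟩
  have hWV : W.1 ≤ g ⁻¹ᵁ V.1 := hW.trans inf_le_right
  have hT' := hT
  rw [T.ideal_comap g V W hWV] at hT'
  have hdiv : ∀ t ∈ T.ideal V, ∃ v, v * σ = g.appLE V.1 W.1 hWV t := fun t ht ↦
    Ideal.mem_span_singleton'.mp (hT' ▸ Ideal.mem_map_of_mem _ ht)
  -- Otherwise all sections of `T` would vanish at `y` to a higher order than `σ`.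
  obtain ⟨t, ht, v, hv, hyv⟩ : ∃ t ∈ T.ideal V, ∃ v, v * σ = g.appLE V.1 W.1 hWV t ∧
      y ∈ Y.basicOpen v := by
    by_contra! H
    let P : Ideal Γ(Y, W.1) := (IsLocalRing.maximalIdeal (Y.presheaf.stalk y)).comap
      (Y.presheaf.germ W.1 y hyW).hom
    have hle : (T.ideal V).map (g.appLE V.1 W.1 hWV).hom ≤ P * Ideal.span {σ} := by
      refine Ideal.map_le_iff_le_comap.mpr fun t ht ↦ ?_
      obtain ⟨v, hv⟩ := hdiv t ht
      refine Ideal.mem_comap.mpr (Ideal.mem_mul_span_singleton.mpr ⟨v, ?_, hv⟩)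
      have := H t ht v hv
      rwa [Scheme.mem_basicOpen _ _ _ hyW] at this
    rw [hT'] at hle
    obtain ⟨p, hp, hpσ⟩ := Ideal.mem_mul_span_singleton.mp (hle (Ideal.mem_span_singleton_self σ))
    have hp1 : p = 1 := by
      rw [← mul_cancel_right_mem_nonZeroDivisors hσ, hpσ, one_mul]
    have : (1 : Γ(Y, W.1)) ∈ P := hp1 ▸ hp
    exact (Ideal.ne_top_iff_one _).mp (Ideal.IsPrime.comap _ : P.IsPrime).ne_top this
  have hle : (Y.affineBasicOpen v).1 ≤ W.1 := Y.basicOpen_le v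
  refine ⟨Y.affineBasicOpen v, hyv, hle.trans (hW.trans inf_le_left), hle.trans hWV, t, ht, ?_⟩
  rw [(T.comap g).ideal_affineBasicOpen_eq_span_mul hT v, hv]
  rw [← ConcreteCategory.comp_apply, Scheme.Hom.appLE_map]
  rfl

/-- The open set of points of `Y` near which the inverse image ideal of `T` is generated by the
section `t` of `T` over the affine open `V`. -/
def genLocus (T : X.IdealSheafData) (g : Y ⟶ X) (V : X.affineOpens) (t : Γ(X, V.1)) : Y.Opens where
  carrier := {y | ∃ (W : Y.affineOpens) (h : W.1 ≤ g ⁻¹ᵁ V.1), y ∈ W.1 ∧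
    (T.comap g).ideal W = Ideal.span {g.appLE V.1 W.1 h t}}
  is_open' := by
    rw [isOpen_iff_forall_mem_open]
    rintro y ⟨W, h, hy, e⟩
    exact ⟨W.1, fun z hz ↦ ⟨W, h, hz, e⟩, W.1.2, hy⟩

variable {T : X.IdealSheafData} {g : Y ⟶ X} {V : X.affineOpens} {t : Γ(X, V.1)}

theorem mem_genLocus {y : Y} : y ∈ genLocus T g V t ↔ ∃ (W : Y.affineOpens)
    (h : W.1 ≤ g ⁻¹ᵁ V.1), y ∈ W.1 ∧ (T.comap g).ideal W = Ideal.span {g.appLE V.1 W.1 h t} :=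
  Iff.rfl

theorem genLocus_le_preimage : genLocus T g V t ≤ g ⁻¹ᵁ V.1 := by
  rintro y ⟨W, h, hy, -⟩
  exact h hy

theorem ideal_comap_comp_eq_span {W : Y.affineOpens} {h : W.1 ≤ g ⁻¹ᵁ V.1}
    (e : (T.comap g).ideal W = Ideal.span {g.appLE V.1 W.1 h t}) {Z : Scheme.{u}} (m : Z ⟶ Y)
    (W' : Z.affineOpens) (h' : W'.1 ≤ m ⁻¹ᵁ W.1) :
    (T.comap (m ≫ g)).ideal W' =
      Ideal.span {(m ≫ g).appLE V.1 W'.1 (h'.trans (m.preimage_mono h)) t} := by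
  rw [Scheme.IdealSheafData.comap_comp, (T.comap g).ideal_comap m W W' h', e, Ideal.map_span,
    Set.image_singleton]
  congr 2
  rw [← Scheme.Hom.appLE_comp_appLE m g V.1 W.1 W'.1 h h']
  rfl

theorem preimage_genLocus_le (m : W ⟶ Y) : m ⁻¹ᵁ genLocus T g V t ≤ genLocus T (m ≫ g) V t := by
  rintro w ⟨U, h, hw, e⟩
  obtain ⟨W', hw', hle⟩ := Scheme.exists_affineOpens_le (U := m ⁻¹ᵁ U.1) hw
  exact ⟨W', hle.trans (m.preimage_mono h), hw', ideal_comap_comp_eq_span e m W' hle⟩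

/-- Whether `t` generates the inverse image of `T` near a point can be tested after base change to
another scheme, provided that both inverse images are effective Cartier divisors. -/
theorem preimage_genLocus (hg : IsEffectiveCartier (T.comap g)) (m : W ⟶ Y)
    (hm : IsEffectiveCartier (T.comap (m ≫ g))) (ht : t ∈ T.ideal V) :
    m ⁻¹ᵁ genLocus T g V t = genLocus T (m ≫ g) V t := by
  refine le_antisymm (preimage_genLocus_le m) fun w hw ↦ ?_
  obtain ⟨U, hU, hwU, eU⟩ := hw
  obtain ⟨U', hyU', -, hU', τ, -, eU'⟩ :=
    hg.exists_generator V (U := ⊤) (y := m w) trivial (hU hwU)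
  obtain ⟨v, hv⟩ : ∃ v, v * g.appLE V.1 U'.1 hU' τ = g.appLE V.1 U'.1 hU' t := by
    refine Ideal.mem_span_singleton'.mp (eU' ▸ ?_)
    rw [T.ideal_comap g V U' hU']
    exact Ideal.mem_map_of_mem _ ht
  obtain ⟨O, hwO, hO⟩ := Scheme.exists_affineOpens_le (U := m ⁻¹ᵁ U'.1 ⊓ U.1) (x := w) ⟨hyU', hwU⟩
  have hO₁ : O.1 ≤ m ⁻¹ᵁ U'.1 := hO.trans inf_le_left
  have eτ := ideal_comap_comp_eq_span eU' m O hO₁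
  have et := ideal_comap_comp_eq_span eU (𝟙 W) O (hO.trans inf_le_right)
  simp only [Category.id_comp] at et
  -- Both `t` and `τ` generate the inverse image near `w`, so their quotient `v` is a unit at `w`.
  obtain ⟨c, hc⟩ := Ideal.mem_span_singleton'.mp
    ((eτ.symm.trans et) ▸ Ideal.mem_span_singleton_self _)
  have hv' := congr_arg (m.appLE U'.1 O.1 hO₁) hv
  rw [map_mul, ← ConcreteCategory.comp_apply, ← ConcreteCategory.comp_apply,
    Scheme.Hom.appLE_comp_appLE] at hv'
  have hu : c * m.appLE U'.1 O.1 hO₁ v = 1 := by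
    rw [← mul_cancel_right_mem_nonZeroDivisors (hm.mem_nonZeroDivisors eτ), mul_assoc, hv', hc,
      one_mul]
  have hwv : m w ∈ Y.basicOpen v := by
    have hw' : w ∈ W.basicOpen (m.appLE U'.1 O.1 hO₁ v) := by
      rw [Scheme.basicOpen_of_isUnit _ (.of_mul_eq_one_right _ hu)]
      exact hwO
    rw [Scheme.basicOpen_appLE] at hw'
    exact hw'.2
  refine ⟨Y.affineBasicOpen v, (Y.basicOpen_le v).trans hU', hwv, ?_⟩
  rw [(T.comap g).ideal_affineBasicOpen_eq_span_mul eU' v, hv, ← ConcreteCategory.comp_apply,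
    Scheme.Hom.appLE_map]
  rfl

theorem genLocus_comp_eq_top (h : genLocus T g V t = ⊤) (m : W ⟶ Y) :
    genLocus T (m ≫ g) V t = ⊤ :=
  top_le_iff.mp ((preimage_genLocus_le m).trans' (by rw [h]; exact m.preimage_top.ge))

theorem genLocus_ι_comp_eq_top : genLocus T ((genLocus T g V t).ι ≫ g) V t = ⊤ :=
  top_le_iff.mp ((preimage_genLocus_le _).trans' (Scheme.Opens.ι_preimage_self _).ge)

/-- A section generating an effective Cartier divisor globally is a non-zero-divisor. -/
theorem appLE_top_mem_nonZeroDivisors (hg : IsEffectiveCartier (T.comap g))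
    (h : genLocus T g V t = ⊤) (hV : ⊤ ≤ g ⁻¹ᵁ V.1) :
    g.appLE V.1 ⊤ hV t ∈ nonZeroDivisors Γ(Y, ⊤) := by
  rw [mem_nonZeroDivisors_iff_left]
  intro a ha
  refine Scheme.section_ext fun y _ ↦ ?_
  obtain ⟨W, hW, hyW, e⟩ := mem_genLocus.mp (h ▸ trivial : y ∈ genLocus T g V t)
  refine ⟨W, le_top, hyW, ?_⟩
  have ha' := congr_arg (Y.presheaf.map (homOfLE (le_top : W.1 ≤ ⊤)).op) ha
  rw [map_mul, ← ConcreteCategory.comp_apply, Scheme.Hom.appLE_map, map_zero] at ha'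
  rw [map_zero]
  exact (mul_left_mem_nonZeroDivisors_eq_zero_iff (hg.mem_nonZeroDivisors e)).mp ha'

end GenLocus

/-! ### Gluing of lifts -/

/-- If lifts through `f` are unique over all open subschemes of `W` and exist locally, then there is
a unique global lift. -/
theorem existsUnique_lift_of_forall_exists {W X Y : Scheme.{u}} (g : W ⟶ X) (f : Y ⟶ X)
    (huniq : ∀ (O : Scheme.{u}) (j : O ⟶ W) [IsOpenImmersion j] (a b : O ⟶ Y),
      a ≫ f = j ≫ g → b ≫ f = j ≫ g → a = b)
    (hex : ∀ w : W, ∃ (O : W.Opens) (a : O.toScheme ⟶ Y), w ∈ O ∧ a ≫ f = O.ι ≫ g) :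
    ∃! h : W ⟶ Y, h ≫ f = g := by
  choose O a hO ha using hex
  let 𝒰 : W.OpenCover := {
    I₀ := W, X w := O w, f w := (O w).ι,
    mem₀ := by
      rw [Scheme.presieve₀_mem_precoverage_iff]
      refine ⟨fun x ↦ ⟨x, by simpa using hO x⟩, inferInstance⟩ }
  refine ⟨Scheme.Cover.glueMorphisms 𝒰 a fun x y ↦ ?_, ?_, fun h hh ↦ ?_⟩
  · refine huniq _ (Limits.pullback.fst (𝒰.f x) (𝒰.f y) ≫ 𝒰.f x) _ _ ?_ ?_
    · rw [Category.assoc, Category.assoc, ha]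
    · rw [Limits.pullback.condition, Category.assoc, Category.assoc, ha]
  · refine Scheme.Cover.hom_ext 𝒰 _ _ fun x ↦ ?_
    rw [Scheme.Cover.ι_glueMorphisms_assoc]
    exact ha x
  · refine huniq _ (𝟙 W) _ _ (by simpa using hh) ?_
    rw [Category.id_comp]
    refine Scheme.Cover.hom_ext 𝒰 _ _ fun x ↦ ?_
    rw [Scheme.Cover.ι_glueMorphisms_assoc]
    exact ha x

/-! ### The charts of the blow-up -/

section SpecMapFromSpec

variable {X : Scheme.{u}} {V : X.affineOpens} {B : CommRingCat.{u}} (φ : Γ(X, V.1) ⟶ B)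

theorem isAffineOpen_coe (V : X.affineOpens) : IsAffineOpen V.1 := V.2

/-- The morphism from an affine scheme to `X` given by a ring homomorphism from the sections over
an affine open. -/
def specMapFromSpec : Spec B ⟶ X := Spec.map φ ≫ (isAffineOpen_coe V).fromSpec

theorem top_le_preimage_specMapFromSpec : ⊤ ≤ specMapFromSpec φ ⁻¹ᵁ V.1 := by
  rw [specMapFromSpec, Scheme.Hom.comp_preimage, (isAffineOpen_coe V).fromSpec_preimage_self,
    Scheme.Hom.preimage_top]

theorem appLE_specMapFromSpec :
    (specMapFromSpec φ).appLE V.1 ⊤ (top_le_preimage_specMapFromSpec φ) =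
      φ ≫ (Scheme.ΓSpecIso B).inv := by
  have hle : ⊤ ≤ Spec.map φ ⁻¹ᵁ (isAffineOpen_coe V).fromSpec ⁻¹ᵁ V.1 :=
    top_le_preimage_specMapFromSpec φ
  have h : (specMapFromSpec φ).appLE V.1 ⊤ (top_le_preimage_specMapFromSpec φ) =
      (isAffineOpen_coe V).fromSpec.app V.1 ≫ (Spec.map φ).appLE _ ⊤ hle :=
    Scheme.Hom.comp_appLE (Spec.map φ) (isAffineOpen_coe V).fromSpec V.1 ⊤ hle
  refine h.trans ?_
  rw [Scheme.ΓSpecIso_inv_naturality, (isAffineOpen_coe V).fromSpec_app_self, Category.assoc,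
    Scheme.Hom.map_appLE]
  rfl

theorem ideal_comap_specMapFromSpec (T : X.IdealSheafData) :
    (T.comap (specMapFromSpec φ)).ideal ⟨⊤, isAffineOpen_top _⟩ =
      ((T.ideal V).map φ.hom).map (Scheme.ΓSpecIso B).inv.hom := by
  rw [T.ideal_comap _ V ⟨⊤, isAffineOpen_top _⟩ (top_le_preimage_specMapFromSpec φ),
    Ideal.map_map, ← CommRingCat.hom_comp, ← appLE_specMapFromSpec]

end SpecMapFromSpec

section ChartRing

variable {X : Scheme.{u}} (T : X.IdealSheafData) (V : X.affineOpens) (t : Γ(X, V.1))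

/-- The ring of sections of the chart of the blow-up of `T` with index `t`. -/
def chartRing : CommRingCat.{u} := CommRingCat.of (blowupChart (T.ideal V) t)

/-- The structure homomorphism of the ring `chartRing T V t`. -/
def chartHom : Γ(X, V.1) ⟶ chartRing T V t :=
  CommRingCat.ofHom (algebraMap Γ(X, V.1) (blowupChart (T.ideal V) t))

theorem chartHom_mem_nonZeroDivisors : chartHom T V t t ∈ nonZeroDivisors (chartRing T V t) :=
  blowupChart.algebraMap_mem_nonZeroDivisors (T.ideal V) t

variable {T V t}

theorem map_chartHom (ht : t ∈ T.ideal V) :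
    (T.ideal V).map (chartHom T V t).hom = Ideal.span {chartHom T V t t} :=
  blowupChart.map_eq_span_singleton (T.ideal V) t ht

theorem chartRing_hom_ext {C : CommRingCat.{u}} {f g : chartRing T V t ⟶ C}
    (h : chartHom T V t ≫ f = chartHom T V t ≫ g)
    (ht : (chartHom T V t ≫ f) t ∈ nonZeroDivisors C) : f = g :=
  CommRingCat.hom_ext (blowupChart.hom_ext (T.ideal V) t (congr_arg CommRingCat.Hom.hom h) ht)

theorem exists_chartHom_comp_eq {C : CommRingCat.{u}} (φ : Γ(X, V.1) ⟶ C)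
    (ht : φ t ∈ nonZeroDivisors C) (hT : ∀ x ∈ T.ideal V, φ t ∣ φ x) :
    ∃ ψ : chartRing T V t ⟶ C, chartHom T V t ≫ ψ = φ := by
  obtain ⟨ψ, hψ⟩ := blowupChart.exists_lift (T.ideal V) t φ.hom ht hT
  exact ⟨CommRingCat.ofHom ψ, CommRingCat.hom_ext hψ⟩

end ChartRing

/-- The affine chart `Spec Γ(V)[T/t] ⟶ X` of the blow-up of `T`. -/
def blowupChartMap {X : Scheme.{u}} (T : X.IdealSheafData) (V : X.affineOpens) (t : Γ(X, V.1)) :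
    Spec (chartRing T V t) ⟶ X :=
  specMapFromSpec (chartHom T V t)

namespace blowupChartMap

variable {X W : Scheme.{u}} {T : X.IdealSheafData} {V : X.affineOpens} {t : Γ(X, V.1)}

theorem top_le_preimage : ⊤ ≤ blowupChartMap T V t ⁻¹ᵁ V.1 :=
  top_le_preimage_specMapFromSpec _

theorem appLE_eq : (blowupChartMap T V t).appLE V.1 ⊤ top_le_preimage =
    chartHom T V t ≫ (Scheme.ΓSpecIso (chartRing T V t)).inv :=
  appLE_specMapFromSpec _

theorem ideal_comap_eq_span (ht : t ∈ T.ideal V) :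
    (T.comap (blowupChartMap T V t)).ideal ⟨⊤, isAffineOpen_top _⟩ =
      Ideal.span {(blowupChartMap T V t).appLE V.1 ⊤ top_le_preimage t} := by
  have h := ideal_comap_specMapFromSpec (chartHom T V t) T
  rw [map_chartHom ht, Ideal.map_span, Set.image_singleton] at h
  rw [appLE_eq]
  exact h

theorem isEffectiveCartier (ht : t ∈ T.ideal V) :
    IsEffectiveCartier (T.comap (blowupChartMap T V t)) := by
  intro x
  refine ⟨⟨⊤, isAffineOpen_top _⟩, trivial, _, ?_, ideal_comap_eq_span ht⟩
  rw [appLE_eq]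
  exact (RingHom.Flat.of_bijective (ConcreteCategory.bijective_of_isIso
    (Scheme.ΓSpecIso (chartRing T V t)).inv)).map_mem_nonZeroDivisors
      (chartHom_mem_nonZeroDivisors T V t)

theorem genLocus_eq_top (ht : t ∈ T.ideal V) : genLocus T (blowupChartMap T V t) V t = ⊤ :=
  top_le_iff.mp fun _ _ ↦
    ⟨⟨⊤, isAffineOpen_top _⟩, top_le_preimage, trivial, ideal_comap_eq_span ht⟩

theorem genLocus_comp_eq_top (ht : t ∈ T.ideal V) (m : W ⟶ Spec (chartRing T V t)) :
    genLocus T (m ≫ blowupChartMap T V t) V t = ⊤ :=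
  _root_.genLocus_comp_eq_top (genLocus_eq_top ht) m

/-- Morphisms over `X` into the chart are unique if the inverse image of the centre is an effective
Cartier divisor. -/
theorem hom_ext (ht : t ∈ T.ideal V) {m m' : W ⟶ Spec (chartRing T V t)}
    (hm : IsEffectiveCartier (T.comap (m ≫ blowupChartMap T V t)))
    (h : m ≫ blowupChartMap T V t = m' ≫ blowupChartMap T V t) : m = m' := by
  refine ext_of_isAffine ?_
  have hV : ∀ n : W ⟶ Spec (chartRing T V t), ⊤ ≤ (n ≫ blowupChartMap T V t) ⁻¹ᵁ V.1 := fun n ↦ by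
    rw [← genLocus_comp_eq_top ht n]
    exact genLocus_le_preimage
  have key : ∀ n : W ⟶ Spec (chartRing T V t),
      chartHom T V t ≫ (Scheme.ΓSpecIso (chartRing T V t)).inv ≫ n.appTop =
      (n ≫ blowupChartMap T V t).appLE V.1 ⊤ (hV n) := fun n ↦ by
    rw [← Scheme.Hom.appLE_comp_appLE n (blowupChartMap T V t) V.1 ⊤ ⊤ top_le_preimage
      n.preimage_top.ge, appLE_eq, Category.assoc]
    congr 2
    exact Scheme.Hom.app_eq_appLE _
  rw [← cancel_epi (Scheme.ΓSpecIso (chartRing T V t)).inv]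
  refine chartRing_hom_ext ?_ ?_
  · rw [key, key]
    simp only [h]
  · rw [key m]
    exact appLE_top_mem_nonZeroDivisors hm (genLocus_comp_eq_top ht m) (hV m)

/-- The universal property of the chart. -/
theorem exists_lift (ht : t ∈ T.ideal V) {g : W ⟶ X} (hg : IsEffectiveCartier (T.comap g))
    (h : genLocus T g V t = ⊤) :
    ∃ m : W ⟶ Spec (chartRing T V t), m ≫ blowupChartMap T V t = g := by
  refine (existsUnique_lift_of_forall_exists g (blowupChartMap T V t) ?_ fun w ↦ ?_).exists
  · intro O j _ a b ha hb
    refine hom_ext ht ?_ (ha.trans hb.symm)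
    rw [ha, Scheme.IdealSheafData.comap_comp]
    exact hg.comap_of_isOpenImmersion j
  · obtain ⟨U, hU, hwU, e⟩ := mem_genLocus.mp (h ▸ trivial : w ∈ genLocus T g V t)
    obtain ⟨ψ, hψ⟩ := exists_chartHom_comp_eq (T := T) (t := t) (g.appLE V.1 U.1 hU)
      (hg.mem_nonZeroDivisors e) (fun x hx ↦ by
        rw [← Ideal.mem_span_singleton]
        refine e ▸ ?_
        rw [T.ideal_comap g V U hU]
        exact Ideal.mem_map_of_mem _ hx)
    refine ⟨U.1, U.1.toSpecΓ ≫ Spec.map ψ, hwU, ?_⟩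
    have h₁ := IsAffineOpen.SpecMap_appLE_fromSpec g (isAffineOpen_coe V) (isAffineOpen_coe U) hU
    rw [blowupChartMap, specMapFromSpec, Category.assoc, ← Spec.map_comp_assoc, hψ, h₁,
      IsAffineOpen.toSpecΓ_fromSpec_assoc]

end blowupChartMap

/-! ### Existence of blow-ups -/

namespace BlowupGluing

variable {X W : Scheme.{u}} (T : X.IdealSheafData)

/-- The charts of the blow-up are indexed by the local sections of the centre. -/
abbrev Index : Type u := Σ V : X.affineOpens, {t : Γ(X, V.1) // t ∈ T.ideal V}

variable {T}

/-- The chart with index `i`. -/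
def chart (i : Index T) : Scheme.{u} := Spec (chartRing T i.1 i.2.1)

/-- The structure morphism of the chart with index `i`. -/
def chartMap (i : Index T) : chart i ⟶ X := blowupChartMap T i.1 i.2.1

/-- The open part of the chart `i` that is glued to the chart `j`: there the section with index `j`
generates the inverse image of `T`. -/
def overlap (i j : Index T) : (chart i).Opens := genLocus T (chartMap i) j.1 j.2.1

theorem isEffectiveCartier_chartMap (i : Index T) : IsEffectiveCartier (T.comap (chartMap i)) :=
  blowupChartMap.isEffectiveCartier i.2.2

theorem chart_hom_ext {i : Index T} {m m' : W ⟶ chart i}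
    (hm : IsEffectiveCartier (T.comap (m ≫ chartMap i)))
    (h : m ≫ chartMap i = m' ≫ chartMap i) : m = m' :=
  blowupChartMap.hom_ext i.2.2 hm h

theorem exists_chart_lift {i : Index T} {g : W ⟶ X} (hg : IsEffectiveCartier (T.comap g))
    (hi : genLocus T g i.1 i.2.1 = ⊤) : ∃ m : W ⟶ chart i, m ≫ chartMap i = g :=
  blowupChartMap.exists_lift i.2.2 hg hi

theorem genLocus_comp_chartMap {i : Index T} (m : W ⟶ chart i) :
    genLocus T (m ≫ chartMap i) i.1 i.2.1 = ⊤ :=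
  blowupChartMap.genLocus_comp_eq_top i.2.2 m

theorem overlap_self (i : Index T) : overlap i i = ⊤ := blowupChartMap.genLocus_eq_top i.2.2

theorem isEffectiveCartier_comp (i : Index T) (m : W ⟶ chart i) [IsOpenImmersion m] :
    IsEffectiveCartier (T.comap (m ≫ chartMap i)) := by
  rw [Scheme.IdealSheafData.comap_comp]
  exact (isEffectiveCartier_chartMap i).comap_of_isOpenImmersion m

theorem overlap_hom_ext {i j : Index T} {m m' : W ⟶ overlap i j}
    (hm : IsEffectiveCartier (T.comap (m ≫ (overlap i j).ι ≫ chartMap i)))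
    (h : m ≫ (overlap i j).ι ≫ chartMap i = m' ≫ (overlap i j).ι ≫ chartMap i) : m = m' := by
  rw [← cancel_mono (overlap i j).ι]
  refine chart_hom_ext ?_ ?_
  · rwa [Category.assoc]
  · rwa [Category.assoc, Category.assoc]

theorem exists_overlap_lift {i j : Index T} {g : W ⟶ X} (hg : IsEffectiveCartier (T.comap g))
    (hi : genLocus T g i.1 i.2.1 = ⊤) (hj : genLocus T g j.1 j.2.1 = ⊤) :
    ∃ m : W ⟶ overlap i j, m ≫ (overlap i j).ι ≫ chartMap i = g := by
  obtain ⟨m, rfl⟩ := exists_chart_lift hg hi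
  have hle : Set.range m ⊆ Set.range (overlap i j).ι := by
    rintro _ ⟨w, rfl⟩
    rw [Scheme.Opens.range_ι]
    have := preimage_genLocus (isEffectiveCartier_chartMap i) m hg j.2.2
    have hw : w ∈ m ⁻¹ᵁ genLocus T (chartMap i) j.1 j.2.1 := by
      rw [this, hj]
      trivial
    exact hw
  exact ⟨IsOpenImmersion.lift (overlap i j).ι m hle, by rw [IsOpenImmersion.lift_fac_assoc]⟩

theorem genLocus_left_eq_top {i j : Index T} (m : W ⟶ overlap i j) :
    genLocus T (m ≫ (overlap i j).ι ≫ chartMap i) i.1 i.2.1 = ⊤ := by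
  rw [← Category.assoc]
  exact genLocus_comp_chartMap _

theorem genLocus_right_eq_top {i j : Index T} (m : W ⟶ overlap i j) :
    genLocus T (m ≫ (overlap i j).ι ≫ chartMap i) j.1 j.2.1 = ⊤ :=
  genLocus_comp_eq_top genLocus_ι_comp_eq_top m

theorem exists_transition (i j : Index T) : ∃ m : (overlap i j).toScheme ⟶ overlap j i,
    m ≫ (overlap j i).ι ≫ chartMap j = (overlap i j).ι ≫ chartMap i := by
  have hi := genLocus_left_eq_top (𝟙 (overlap i j).toScheme)
  have hj := genLocus_right_eq_top (𝟙 (overlap i j).toScheme)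
  rw [Category.id_comp] at hi hj
  exact exists_overlap_lift (isEffectiveCartier_comp i _) hj hi

/-- The transition maps between the charts are the unique morphisms over `X`. -/
def transition (i j : Index T) : (overlap i j).toScheme ⟶ overlap j i :=
  (exists_transition i j).choose

theorem transition_comp (i j : Index T) :
    transition i j ≫ (overlap j i).ι ≫ chartMap j = (overlap i j).ι ≫ chartMap i :=
  (exists_transition i j).choose_spec

open Limits

theorem exists_tripleTransition (i j k : Index T) :
    ∃ m : pullback (overlap i j).ι (overlap i k).ι ⟶ pullback (overlap j k).ι (overlap j i).ι,
      m ≫ pullback.fst _ _ ≫ (overlap j k).ι ≫ chartMap j =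
        pullback.fst _ _ ≫ (overlap i j).ι ≫ chartMap i := by
  have hC : IsEffectiveCartier (T.comap
      ((pullback.fst (overlap i j).ι (overlap i k).ι ≫ (overlap i j).ι) ≫ chartMap i)) :=
    isEffectiveCartier_comp i _
  rw [Category.assoc] at hC
  have hi := genLocus_left_eq_top (pullback.fst (overlap i j).ι (overlap i k).ι)
  have hj := genLocus_right_eq_top (pullback.fst (overlap i j).ι (overlap i k).ι)
  have hk := genLocus_right_eq_top (pullback.snd (overlap i j).ι (overlap i k).ι)
  rw [← pullback.condition_assoc] at hk
  obtain ⟨a, ha⟩ := exists_overlap_lift hC hj hk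
  obtain ⟨b, hb⟩ := exists_overlap_lift hC hj hi
  refine ⟨pullback.lift a b (chart_hom_ext ?_ ?_), ?_⟩
  · rwa [Category.assoc, ha]
  · rw [Category.assoc, Category.assoc, ha, hb]
  · rw [pullback.lift_fst_assoc, ha]

/-- The transition maps between the triple overlaps. -/
def tripleTransition (i j k : Index T) :
    pullback (overlap i j).ι (overlap i k).ι ⟶ pullback (overlap j k).ι (overlap j i).ι :=
  (exists_tripleTransition i j k).choose

theorem tripleTransition_comp (i j k : Index T) :
    tripleTransition i j k ≫ pullback.fst _ _ ≫ (overlap j k).ι ≫ chartMap j =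
      pullback.fst _ _ ≫ (overlap i j).ι ≫ chartMap i :=
  (exists_tripleTransition i j k).choose_spec

variable (T) in
/-- The glue data of the blow-up of `T`. All compatibilities follow from the uniqueness of morphisms
into the charts. -/
def glueData : Scheme.GlueData.{u} where
  J := Index T
  U := chart
  V ij := overlap ij.1 ij.2
  f i j := (overlap i j).ι
  f_id i := by
    rw [overlap_self]
    exact inferInstanceAs (IsIso (chart i).topIso.hom)
  t := transition
  t_id i := overlap_hom_ext
    (by rw [transition_comp]; exact isEffectiveCartier_comp i _)
    (by rw [transition_comp, Category.id_comp])
  t' := tripleTransition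
  t_fac i j k := by
    have h : (tripleTransition i j k ≫ pullback.snd _ _) ≫ (overlap j i).ι ≫ chartMap j =
        (pullback.fst _ _ ≫ (overlap i j).ι) ≫ chartMap i := by
      rw [Category.assoc, ← pullback.condition_assoc, tripleTransition_comp, Category.assoc]
    refine overlap_hom_ext ?_ ?_
    · rw [h]
      exact isEffectiveCartier_comp i _
    · rw [h, Category.assoc, Category.assoc, transition_comp]
  cocycle i j k := by
    rw [← cancel_mono (pullback.fst _ _)]
    have h : ((tripleTransition i j k ≫ tripleTransition j k i ≫ tripleTransition k i j) ≫
        pullback.fst _ _) ≫ (overlap i j).ι ≫ chartMap i =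
        (pullback.fst _ _ ≫ (overlap i j).ι) ≫ chartMap i := by
      simp only [Category.assoc, tripleTransition_comp]
    refine overlap_hom_ext ?_ ?_
    · rw [h]
      exact isEffectiveCartier_comp i _
    · rw [h, Category.id_comp, Category.assoc]
  f_open i j := inferInstance

variable (T) in
/-- The blow-up of `T`, glued from its charts. -/
def blowup : Scheme.{u} := (glueData T).glued

/-- The inclusion of a chart into the blow-up. -/
def ι (i : Index T) : chart i ⟶ blowup T := (glueData T).ι i

instance (i : Index T) : IsOpenImmersion (ι i) := (glueData T).ι_isOpenImmersion i

theorem exists_ι_eq (y : blowup T) : ∃ (i : Index T) (x : chart i), ι i x = y :=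
  (glueData T).ι_jointly_surjective y

theorem transition_ι (i j : Index T) :
    transition i j ≫ (overlap j i).ι ≫ ι j = (overlap i j).ι ≫ ι i :=
  (glueData T).glue_condition i j

theorem exists_toBase : ∃ f : blowup T ⟶ X, ∀ i, ι i ≫ f = chartMap i :=
  ⟨Multicoequalizer.desc (glueData T).diagram _ chartMap fun ij ↦
    ((transition_comp ij.1 ij.2).symm.trans (Category.assoc _ _ _).symm),
    fun i ↦ Multicoequalizer.π_desc (glueData T).diagram _ chartMap _ i⟩

variable (T) in
/-- The structure morphism of the blow-up. -/
def toBase : blowup T ⟶ X := exists_toBase.choose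

theorem ι_toBase (i : Index T) : ι i ≫ toBase T = chartMap i := exists_toBase.choose_spec i

/-- Two morphisms over `X` into the charts `i` and `j` agree in the glued scheme. -/
theorem comp_ι_eq {i j : Index T} {a : W ⟶ chart i} {b : W ⟶ chart j}
    (hW : IsEffectiveCartier (T.comap (a ≫ chartMap i)))
    (h : a ≫ chartMap i = b ≫ chartMap j) : a ≫ ι i = b ≫ ι j := by
  have hj : genLocus T (a ≫ chartMap i) j.1 j.2.1 = ⊤ := by
    rw [h]
    exact genLocus_comp_chartMap b
  obtain ⟨m, hm⟩ := exists_overlap_lift hW (genLocus_comp_chartMap a) hj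
  have ha : m ≫ (overlap i j).ι = a :=
    chart_hom_ext (by rwa [Category.assoc, hm]) (by rw [Category.assoc, hm])
  have hb : m ≫ transition i j ≫ (overlap j i).ι = b := by
    have e : (m ≫ transition i j ≫ (overlap j i).ι) ≫ chartMap j = b ≫ chartMap j := by
      rw [Category.assoc, Category.assoc, transition_comp, hm, h]
    refine chart_hom_ext ?_ e
    rwa [e, ← h]
  rw [← ha, ← hb, Category.assoc, Category.assoc, Category.assoc, transition_ι]

theorem isBlowup : IsBlowup (toBase T) T where
  isEffectiveCartier := by
    refine IsEffectiveCartier.of_forall_exists fun y ↦ ?_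
    obtain ⟨i, x, rfl⟩ := exists_ι_eq y
    refine ⟨chart i, ι i, inferInstance, ⟨x, rfl⟩, ?_⟩
    rw [← Scheme.IdealSheafData.comap_comp, ι_toBase]
    exact isEffectiveCartier_chartMap i
  existsUnique_lift W g hg := by
    refine existsUnique_lift_of_forall_exists g (toBase T) ?_ fun w ↦ ?_
    · intro O j _ a b ha hb
      refine Scheme.hom_ext_of_forall _ _ fun x ↦ ?_
      obtain ⟨i, y, hy⟩ := exists_ι_eq (a x)
      obtain ⟨k, z, hz⟩ := exists_ι_eq (b x)
      let U : O.Opens := a ⁻¹ᵁ (ι i).opensRange ⊓ b ⁻¹ᵁ (ι k).opensRange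
      have hUa : Set.range (U.ι ≫ a) ⊆ Set.range (ι i) := by
        rintro _ ⟨p, rfl⟩
        exact p.2.1
      have hUb : Set.range (U.ι ≫ b) ⊆ Set.range (ι k) := by
        rintro _ ⟨p, rfl⟩
        exact p.2.2
      refine ⟨U, ⟨⟨y, hy⟩, ⟨z, hz⟩⟩, ?_⟩
      have ea := IsOpenImmersion.lift_fac (ι i) (U.ι ≫ a) hUa
      have eb := IsOpenImmersion.lift_fac (ι k) (U.ι ≫ b) hUb
      have ea' : IsOpenImmersion.lift (ι i) (U.ι ≫ a) hUa ≫ chartMap i = (U.ι ≫ j) ≫ g := by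
        rw [← ι_toBase, reassoc_of% ea, ha, Category.assoc]
      have eb' : IsOpenImmersion.lift (ι k) (U.ι ≫ b) hUb ≫ chartMap k = (U.ι ≫ j) ≫ g := by
        rw [← ι_toBase, reassoc_of% eb, hb, Category.assoc]
      rw [← ea, ← eb]
      refine comp_ι_eq ?_ (ea'.trans eb'.symm)
      rw [ea', Scheme.IdealSheafData.comap_comp]
      exact hg.comap_of_isOpenImmersion _
    · obtain ⟨V, hV, -⟩ := Scheme.exists_affineOpens_le (U := ⊤) (x := g w) trivial
      obtain ⟨U, hwU, -, hUV, t, ht, e⟩ := hg.exists_generator V (U := ⊤) (y := w) trivial hV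
      have hU : IsEffectiveCartier (T.comap (U.1.ι ≫ g)) := by
        rw [Scheme.IdealSheafData.comap_comp]
        exact hg.comap_of_isOpenImmersion _
      have hgen : genLocus T (U.1.ι ≫ g) V t = ⊤ := by
        refine top_le_iff.mp ((preimage_genLocus_le _).trans' ?_)
        rintro ⟨p, hp⟩ -
        exact ⟨U, hUV, hp, e⟩
      obtain ⟨m, hm⟩ := exists_chart_lift (i := ⟨V, t, ht⟩) hU hgen
      exact ⟨U.1, m ≫ ι ⟨V, t, ht⟩, hwU, by rw [Category.assoc, ι_toBase, hm]⟩

end BlowupGluing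

/-- Every ideal sheaf has a blow-up. -/
theorem exists_isBlowup {X : Scheme.{u}} (T : X.IdealSheafData) :
    ∃ (Y : Scheme.{u}) (f : Y ⟶ X), IsBlowup f T :=
  ⟨_, _, BlowupGluing.isBlowup⟩

/-! ### Properties of blow-ups -/

namespace IsBlowup

variable {X Y : Scheme.{u}} {f : Y ⟶ X} {T : X.IdealSheafData}

theorem hom_ext (hf : IsBlowup f T) {W : Scheme.{u}} {a b : W ⟶ Y}
    (hW : IsEffectiveCartier (T.comap (a ≫ f))) (h : a ≫ f = b ≫ f) : a = b :=
  (hf.existsUnique_lift W (a ≫ f) hW).unique rfl h.symm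

theorem isEffectiveCartier_comp (hf : IsBlowup f T) {W : Scheme.{u}} (a : W ⟶ Y)
    [IsOpenImmersion a] : IsEffectiveCartier (T.comap (a ≫ f)) := by
  rw [Scheme.IdealSheafData.comap_comp]
  exact hf.isEffectiveCartier.comap_of_isOpenImmersion a

theorem _root_.comap_eq_top_of_mem_ideal {V : X.affineOpens} {t : Γ(X, V.1)} (ht : t ∈ T.ideal V) :
    T.comap (X.basicOpen t).ι = ⊤ := by
  rw [← Scheme.IdealSheafData.support_eq_bot_iff, Scheme.IdealSheafData.support_comap]
  refine le_bot_iff.mp ?_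
  rintro ⟨x, hx⟩ hxT
  have hxT : x ∈ T.support := hxT
  rw [Scheme.IdealSheafData.mem_support_iff_of_mem (U := V) (X.basicOpen_le t hx),
    Scheme.mem_zeroLocus_iff] at hxT
  exact (hxT t ht hx).elim

/-- A blow-up maps non-zero-divisors to non-zero-divisors: the complement of the exceptional divisor
is schematically dense, and it is isomorphic to the complement of the centre. -/
theorem appLE_mem_nonZeroDivisors (hf : IsBlowup f T) (V : X.affineOpens) (W : Y.affineOpens)
    (h : W.1 ≤ f ⁻¹ᵁ V.1) {s : Γ(X, V.1)} (hs : s ∈ nonZeroDivisors Γ(X, V.1)) :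
    f.appLE V.1 W.1 h s ∈ nonZeroDivisors Γ(Y, W.1) := by
  rw [mem_nonZeroDivisors_iff_left]
  intro a ha
  refine Scheme.section_ext fun y hy ↦ ?_
  obtain ⟨W', hyW', hle, hW'V, t, ht, e⟩ := hf.isEffectiveCartier.exists_generator V hy (h hy)
  refine ⟨W', hle, hyW', ?_⟩
  rw [map_zero]
  set τ := f.appLE V.1 W'.1 hW'V t with hτ
  set b := Y.presheaf.map (homOfLE hle).op a with hb
  have hsb : f.appLE V.1 W'.1 hW'V s * b = 0 := by
    have := congr_arg (Y.presheaf.map (homOfLE hle).op) ha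
    rwa [map_mul, map_zero, ← ConcreteCategory.comp_apply, Scheme.Hom.appLE_map] at this
  -- `D` is the complement of the exceptional divisor in `W'`, and `U` is that of the centre in `V`.
  let D : Y.Opens := Y.basicOpen τ
  let U : X.Opens := X.basicOpen t
  have hDW : D ≤ W'.1 := Y.basicOpen_le τ
  have hDU : D ≤ f ⁻¹ᵁ U := by
    change Y.basicOpen (f.appLE V.1 W'.1 hW'V t) ≤ _
    rw [Scheme.basicOpen_appLE]
    exact inf_le_right
  obtain ⟨k, hk⟩ := (hf.existsUnique_lift U.toScheme U.ι
    (by rw [comap_eq_top_of_mem_ideal ht]; exact IsEffectiveCartier.top)).exists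
  let q : D.toScheme ⟶ U.toScheme := f.resLE U D hDU
  have hq : q ≫ k = D.ι := by
    have hqf : D.ι ≫ f = (q ≫ k) ≫ f := by
      rw [Category.assoc, hk, Scheme.Hom.resLE_comp_ι]
    exact (hf.hom_ext (hf.isEffectiveCartier_comp D.ι) hqf).symm
  -- The section `b` vanishes on `D`, because its inverse image on `U` is killed by `s`.
  have hkb : k.appLE W'.1 (k ⁻¹ᵁ D) (k.preimage_mono hDW) b = 0 := by
    refine Scheme.section_ext fun x hx ↦ ?_
    obtain ⟨O, hxO, hO⟩ := Scheme.exists_affineOpens_le hx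
    refine ⟨O, hO, hxO, ?_⟩
    have hOW : O.1 ≤ k ⁻¹ᵁ W'.1 := hO.trans (k.preimage_mono hDW)
    have hOV : O.1 ≤ U.ι ⁻¹ᵁ V.1 := fun p _ ↦ X.basicOpen_le t p.2
    have hsO := Scheme.Hom.appLE_mem_nonZeroDivisors U.ι V O hOV hs
    have := congr_arg (k.appLE W'.1 O.1 hOW) hsb
    rw [map_mul, map_zero, ← ConcreteCategory.comp_apply, Scheme.Hom.appLE_comp_appLE] at this
    simp only [hk] at this
    rw [map_zero, ← ConcreteCategory.comp_apply, Scheme.Hom.appLE_map]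
    exact (mul_left_mem_nonZeroDivisors_eq_zero_iff hsO).mp this
  have hqD : ⊤ ≤ q ⁻¹ᵁ k ⁻¹ᵁ D := by
    rw [← Scheme.Hom.comp_preimage, hq, Scheme.Opens.ι_preimage_self]
  have hD : Y.presheaf.map (homOfLE hDW).op b = 0 := by
    have h₁ := congr_arg (q.appLE (k ⁻¹ᵁ D) ⊤ hqD) hkb
    rw [map_zero, ← ConcreteCategory.comp_apply, Scheme.Hom.appLE_comp_appLE] at h₁
    simp only [hq] at h₁
    refine (ConcreteCategory.bijective_of_isIso
      (D.ι.appLE D ⊤ D.ι_preimage_self.ge)).injective ?_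
    rwa [map_zero, ← ConcreteCategory.comp_apply, Scheme.Hom.map_appLE]
  obtain ⟨n, hn⟩ :=
    exists_pow_mul_eq_zero_of_res_basicOpen_eq_zero_of_isAffineOpen Y W'.2 b τ hD
  exact (mul_left_mem_nonZeroDivisors_eq_zero_iff
    (pow_mem (hf.isEffectiveCartier.mem_nonZeroDivisors e) n)).mp hn

/-- An inclusion of ideals that holds on the blow-up holds on the affine charts. -/
theorem map_chartHom_le (hf : IsBlowup f T) {V : X.affineOpens} {t : Γ(X, V.1)}
    (ht : t ∈ T.ideal V) {I J : Ideal Γ(X, V.1)}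
    (h : ∀ (W : Y.affineOpens) (h : W.1 ≤ f ⁻¹ᵁ V.1),
      I.map (f.appLE V.1 W.1 h).hom ≤ J.map (f.appLE V.1 W.1 h).hom) :
    I.map (chartHom T V t).hom ≤ J.map (chartHom T V t).hom := by
  obtain ⟨m, hm⟩ := (hf.existsUnique_lift _ (blowupChartMap T V t)
    (blowupChartMap.isEffectiveCartier ht)).exists
  have key : I.map ((blowupChartMap T V t).appLE V.1 ⊤ blowupChartMap.top_le_preimage).hom ≤
      J.map ((blowupChartMap T V t).appLE V.1 ⊤ blowupChartMap.top_le_preimage).hom := by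
    refine Scheme.ideal_le_of_forall_exists (V := ⟨⊤, isAffineOpen_top _⟩) fun x _ ↦ ?_
    have hx : f (m x) ∈ V.1 := by
      rw [← Scheme.Hom.comp_apply, hm]
      exact blowupChartMap.top_le_preimage (V := V) (t := t) (T := T) (x := x) trivial
    obtain ⟨W, hxW, hW⟩ := Scheme.exists_affineOpens_le (U := f ⁻¹ᵁ V.1) (x := m x) hx
    obtain ⟨O, hxO, hO⟩ := Scheme.exists_affineOpens_le (U := m ⁻¹ᵁ W.1) (x := x) hxW
    refine ⟨O, le_top, hxO, ?_⟩
    have e : (blowupChartMap T V t).appLE V.1 ⊤ blowupChartMap.top_le_preimage ≫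
        (Spec (chartRing T V t)).presheaf.map (homOfLE (le_top : O.1 ≤ ⊤)).op =
        f.appLE V.1 W.1 hW ≫ m.appLE W.1 O.1 hO := by
      rw [Scheme.Hom.appLE_map, Scheme.Hom.appLE_comp_appLE]
      simp only [hm]
    rw [Ideal.map_map, Ideal.map_map, ← CommRingCat.hom_comp, e, CommRingCat.hom_comp,
      ← Ideal.map_map, ← Ideal.map_map]
    exact Ideal.map_mono (h W hW)
  have key' := Ideal.map_mono (f := (Scheme.ΓSpecIso (chartRing T V t)).hom.hom) key
  rwa [Ideal.map_map, Ideal.map_map, ← CommRingCat.hom_comp, blowupChartMap.appLE_eq,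
    Category.assoc, Iso.inv_hom_id, Category.comp_id] at key'

end IsBlowup

/-! ### Faithfulness of ideals cosupported in effective Cartier divisors -/

/-- A section killed by an ideal sheaf that is cosupported in effective Cartier divisors is zero,
since no associated point lies on an effective Cartier divisor. -/
theorem eq_zero_of_support_subset {X : Scheme.{u}} [IsLocallyNoetherian X]
    {Z : Set X.IdealSheafData} (hZ : ∀ D ∈ Z, IsEffectiveCartier D) {T : X.IdealSheafData}
    (hT : (T.support : Set X) ⊆ ⋃ D ∈ Z, (D.support : Set X)) {V : X.affineOpens} {a : Γ(X, V.1)}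
    (ha : ∀ d ∈ T.ideal V, d * a = 0) : a = 0 := by
  have : IsNoetherianRing Γ(X, V.1) := IsLocallyNoetherian.component_noetherian V
  by_contra ha0
  obtain ⟨P, hP, hle⟩ := exists_le_isAssociatedPrime_of_isNoetherianRing Γ(X, V.1) a ha0
  obtain ⟨hPprime, y, hy⟩ := isAssociatedPrime_iff.mp hP
  have hmemP : ∀ d, d ∈ P ↔ d * y = 0 := fun d ↦ by
    rw [hy, Submodule.mem_colon_singleton, Submodule.mem_bot, smul_eq_mul]
  let p : X := (isAffineOpen_coe V).fromSpec ⟨P, hPprime⟩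
  have hpV : p ∈ V.1 := by
    have : p ∈ Set.range (isAffineOpen_coe V).fromSpec := ⟨_, rfl⟩
    rwa [(isAffineOpen_coe V).range_fromSpec] at this
  have hp : ∀ d : Γ(X, V.1), p ∈ X.basicOpen d ↔ d ∉ P := fun d ↦ by
    have h := (isAffineOpen_coe V).fromSpec_preimage_basicOpen d
    have h' : (⟨P, hPprime⟩ : PrimeSpectrum Γ(X, V.1)) ∈
        (isAffineOpen_coe V).fromSpec ⁻¹ᵁ X.basicOpen d ↔
        (⟨P, hPprime⟩ : PrimeSpectrum Γ(X, V.1)) ∈ PrimeSpectrum.basicOpen d := by rw [h]; rfl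
    exact h'
  have hsupp : ∀ E : X.IdealSheafData, p ∈ E.support ↔ E.ideal V ≤ P := fun E ↦ by
    rw [Scheme.IdealSheafData.mem_support_iff_of_mem hpV, Scheme.mem_zeroLocus_iff]
    exact forall₂_congr fun d _ ↦ by rw [hp, not_not]
  have hTP : T.ideal V ≤ P := fun d hd ↦ hle (by
    rw [Submodule.mem_colon_singleton, Submodule.mem_bot]
    exact ha d hd)
  obtain ⟨D, hD, hpD⟩ := Set.mem_iUnion₂.mp (hT ((hsupp T).mpr hTP))
  have hy0 : y = 0 :=
    (hZ D hD).eq_zero_of_forall_mul_eq_zero fun d hd ↦ (hmemP d).mp ((hsupp D).mp hpD hd)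
  exact hPprime.ne_top ((Ideal.eq_top_iff_one P).mpr ((hmemP 1).mpr (by rw [hy0, mul_zero])))

/-! ### Integral dependence and equality on blow-ups -/

namespace FractionalIdealSheaf

variable {X Y : Scheme.{u}} {I J : FractionalIdealSheaf X} {T : X.IdealSheafData} {f : Y ⟶ X}

/-- On a blow-up, equality of inverse images can be tested on numerators. -/
theorem pullbackFractions_eq_iff (hf : IsBlowup f T) (hIJ : I ≤ J) {V : X.affineOpens}
    {W : Y.affineOpens} (h : W.1 ≤ f ⁻¹ᵁ V.1) {s : Γ(X, V.1)} (hs : s ∈ nonZeroDivisors Γ(X, V.1))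
    (hsJ : ∀ x ∈ J.sections V, IsLocalization.IsInteger Γ(X, V.1) (s • x)) :
    pullbackFractions (f.appLE V.1 W.1 h).hom (I.sections V) =
      pullbackFractions (f.appLE V.1 W.1 h).hom (J.sections V) ↔
    (numeratorIdeal s (I.sections V)).map (f.appLE V.1 W.1 h).hom =
      (numeratorIdeal s (J.sections V)).map (f.appLE V.1 W.1 h).hom := by
  have hφ : ∀ r ∈ nonZeroDivisors Γ(X, V.1), (f.appLE V.1 W.1 h).hom r ∈
      nonZeroDivisors Γ(Y, W.1) := fun r hr ↦ hf.appLE_mem_nonZeroDivisors V W h hr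
  obtain ⟨hJ₁, hJ₂⟩ := numeratorIdeal_pullbackFractions _ hφ hs hsJ
  obtain ⟨hI₁, hI₂⟩ := numeratorIdeal_pullbackFractions _ hφ hs
    (fun x hx ↦ hsJ x (hIJ V hx) : ∀ x ∈ I.sections V, _)
  rw [← hI₁, ← hJ₁]
  exact ⟨fun e ↦ by rw [e], eq_of_numeratorIdeal_eq (hφ s hs) hI₂ hJ₂⟩

/-- If `J` is integral over `I`, then both have the same inverse image on the blow-up of `D J`:
there, the inverse image of `J` is invertible, and `I` is a reduction of `J`. -/
theorem IsIntegralOver.pullbackEq (h : IsIntegralOver I J) (hIJ : I ≤ J) (D : X.IdealSheafData)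
    (hT : ∀ V, IsLocalization.coeSubmodule (FractionRing Γ(X, V.1)) (T.ideal V) =
      D.ideal V • J.sections V) (hf : IsBlowup f T) : PullbackEq f I J := by
  intro V W hWV
  obtain ⟨s, hs, hsJ⟩ := exists_isInteger_smul (J.fg V)
  rw [pullbackFractions_eq_iff hf hIJ hWV hs hsJ]
  refine le_antisymm (Ideal.map_mono (numeratorIdeal_mono s (hIJ V))) ?_
  obtain ⟨N, hN⟩ := Ideal.exists_pow_succ_le_mul_pow
    (numeratorIdeal_fg (J.fg V) hsJ) (I := numeratorIdeal s (I.sections V)) fun a ha ↦ by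
      obtain ⟨z, hz, hza⟩ := mem_numeratorIdeal.mp ha
      exact exists_pow_succ_mem_of_integral_equation (hIJ V) hsJ hz hza (h V z hz)
  refine Scheme.ideal_le_of_forall_exists fun y hy ↦ ?_
  obtain ⟨W', hyW', hle, hW'V, t, ht, e⟩ := hf.isEffectiveCartier.exists_generator V hy (hWV hy)
  refine ⟨W', hle, hyW', ?_⟩
  rw [Ideal.map_map, Ideal.map_map, ← CommRingCat.hom_comp, Scheme.Hom.appLE_map]
  set φ := (f.appLE V.1 W'.1 hW'V).hom with hφ
  refine Ideal.le_of_pow_succ_le_mul_pow (E := (D.ideal V).map φ) (σ := φ s * φ t) (N := N)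
    (mul_mem (hf.appLE_mem_nonZeroDivisors V W' hW'V hs)
      (hf.isEffectiveCartier.mem_nonZeroDivisors e)) ?_ ?_
  · rw [← Ideal.map_mul, ← span_singleton_mul_eq_mul_numeratorIdeal hsJ (hT V), Ideal.map_mul,
      Ideal.map_span, Set.image_singleton, ← T.ideal_comap f V W' hW'V, e,
      Ideal.span_singleton_mul_span_singleton]
  · rw [← Ideal.map_pow, ← Ideal.map_pow, ← Ideal.map_mul]
    exact Ideal.map_mono hN

/-- If `I` and `J` have the same inverse image on the blow-up of `T`, then `J` is integral over `I`,
provided that a section killed by a power of `T` is also killed by a power of every numerator of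
`J`. -/
theorem PullbackEq.isIntegralOver [IsLocallyNoetherian X] (h : PullbackEq f I J) (hIJ : I ≤ J)
    (hf : IsBlowup f T)
    (hT : ∀ (V : X.affineOpens), ∀ s ∈ nonZeroDivisors Γ(X, V.1),
      (∀ x ∈ J.sections V, IsLocalization.IsInteger Γ(X, V.1) (s • x)) →
      ∀ z ∈ numeratorIdeal s (J.sections V), ∀ (N : ℕ) (a : Γ(X, V.1)),
        (∀ d ∈ T.ideal V ^ N, d * a = 0) → ∃ m, a * z ^ m = 0) : IsIntegralOver I J := by
  intro V z hz
  have : IsNoetherianRing Γ(X, V.1) := IsLocallyNoetherian.component_noetherian V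
  obtain ⟨s, hs, hsJ⟩ := exists_isInteger_smul (J.fg V)
  obtain ⟨a, ha⟩ := hsJ z hz
  have haJ : a ∈ numeratorIdeal s (J.sections V) := mem_numeratorIdeal.mpr ⟨z, hz, ha.symm⟩
  refine integral_equation_of_numerators hs ha.symm ?_
  obtain ⟨N, n, c, hn, hc, hker⟩ := exists_integral_equation_of_mem_blowupChart
    (I := numeratorIdeal s (I.sections V)) (IsNoetherian.noetherian (T.ideal V)) (z := a)
    fun t ht ↦ hf.map_chartHom_le ht
      (fun W hW ↦ ((pullbackFractions_eq_iff hf hIJ hW hs hsJ).mp (h V W hW)).ge)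
      (Ideal.mem_map_of_mem _ haJ)
  obtain ⟨m, hm⟩ := hT V s hs hsJ a haJ N _ fun d hd ↦ (mul_comm _ _).trans (hker d hd)
  exact exists_integral_equation_of_mul_pow hn hc m hm

/-- No section is killed by a power of an ideal sheaf that is cosupported in effective Cartier
divisors, so the equation of integral dependence holds exactly. -/
theorem IsIntegralExtension.isIntegralOver [IsLocallyNoetherian X] {Z : Set X.IdealSheafData}
    (hZ : ∀ D ∈ Z, IsEffectiveCartier D) (hIJ : I ≤ J) (h : IsIntegralExtension Z I J) :
    IsIntegralOver I J := by
  obtain ⟨T, -, hT, Y, f, hf, hpb⟩ := h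
  refine hpb.isIntegralOver hIJ hf fun V s _ _ z _ N a ha ↦ ⟨0, ?_⟩
  rw [Ideal.eq_zero_of_forall_pow_mul_eq_zero
    (fun b hb ↦ eq_zero_of_support_subset hZ hT hb) N ha, zero_mul]

/-- A section killed by a power of `D J` is killed by the same power of each numerator of `J`, as
`D` is invertible. -/
theorem EqAfterBlowup.isIntegralOver [IsLocallyNoetherian X] (hIJ : I ≤ J)
    (h : EqAfterBlowup I J) : IsIntegralOver I J := by
  obtain ⟨Y, f, ⟨D, T, hD, hT, hf⟩, hpb⟩ := h
  refine hpb.isIntegralOver hIJ hf fun V s hs hsJ z hz N a ha ↦ ⟨N, ?_⟩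
  refine Ideal.eq_zero_of_forall_pow_mul_eq_zero
    (fun b hb ↦ hD.eq_zero_of_forall_mul_eq_zero hb) N (I := D.ideal V) fun d hd ↦ ?_
  have hmem : d * z ^ N ∈ Ideal.span {s} ^ N * T.ideal V ^ N := by
    rw [← mul_pow, span_singleton_mul_eq_mul_numeratorIdeal hsJ (hT V), mul_pow]
    exact Ideal.mul_mem_mul hd (Ideal.pow_mem_pow hz N)
  rw [Ideal.span_singleton_pow] at hmem
  obtain ⟨e, he, hez⟩ := Ideal.mem_span_singleton_mul.mp hmem
  rw [mul_left_comm, ← hez, mul_left_comm, mul_comm a e, ha e he, mul_zero]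

end FractionalIdealSheaf

/-! ### Clearing the denominators of a fractional ideal by one effective Cartier divisor -/

theorem smul_le_one_iff_mul_numeratorIdeal_le {A : Type u} [CommRing A] {s : A}
    (hs : s ∈ nonZeroDivisors A) {N : Submodule A (FractionRing A)}
    (hN : ∀ x ∈ N, IsLocalization.IsInteger A (s • x)) {D : Ideal A} :
    D • N ≤ 1 ↔ D * numeratorIdeal s N ≤ Ideal.span {s} := by
  have hinj := IsFractionRing.injective A (FractionRing A)
  refine ⟨fun h ↦ Ideal.mul_le.mpr fun d hd a ha ↦ ?_,
    fun h ↦ Submodule.smul_le.mpr fun d hd x hx ↦ ?_⟩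
  · obtain ⟨x, hx, hxa⟩ := mem_numeratorIdeal.mp ha
    obtain ⟨c, hc⟩ := Submodule.mem_one.mp (h (Submodule.smul_mem_smul hd hx))
    refine Ideal.mem_span_singleton.mpr ⟨c, hinj ?_⟩
    rw [map_mul, ← hxa, map_mul, hc, Algebra.smul_def, Algebra.smul_def, mul_left_comm]
  · obtain ⟨a, ha⟩ := hN x hx
    obtain ⟨c, hc⟩ := Ideal.mem_span_singleton.mp
      (h (Ideal.mul_mem_mul hd (mem_numeratorIdeal.mpr ⟨x, hx, ha.symm⟩)))
    refine Submodule.mem_one.mpr ⟨c, smul_right_injective_fractionRing hs ?_⟩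
    rw [smul_comm, ← ha, Algebra.smul_def, Algebra.smul_def, ← map_mul, ← map_mul, hc]

theorem Ideal.span_singleton_mul_right_injective_of_mem_nonZeroDivisors {A : Type*} [CommRing A]
    {s : A} (hs : s ∈ nonZeroDivisors A) :
    Function.Injective (Ideal.span {s} * · : Ideal A → Ideal A) := by
  have key : ∀ I J : Ideal A, Ideal.span {s} * I ≤ Ideal.span {s} * J → I ≤ J := by
    intro I J h x hx
    obtain ⟨y, hy, e⟩ := Ideal.mem_span_singleton_mul.mp
      (h (Ideal.mul_mem_mul (Ideal.mem_span_singleton_self s) hx))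
    rwa [← (mul_cancel_left_mem_nonZeroDivisors hs).mp e]
  exact fun I J h ↦ le_antisymm (key I J h.le) (key J I h.ge)

theorem mul_smul_le_one {A : Type u} [CommRing A] {N : Submodule A (FractionRing A)}
    {D : Ideal A} (h : D • N ≤ 1) (E : Ideal A) : (D * E) • N ≤ 1 :=
  (Submodule.smul_mono_left Ideal.mul_le_left).trans h

namespace FractionalIdealSheaf

variable {X : Scheme.{u}} {I J : FractionalIdealSheaf X} {Z : Set X.IdealSheafData}

/-- The numerators over a basic open are generated by the numerators over the whole. -/
theorem numeratorIdeal_basicOpen {V W : X.affineOpens} (h : W.1 ≤ V.1) {g : Γ(X, V.1)}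
    (hW : W.1 = X.basicOpen g) {s : Γ(X, V.1)} (hs : s ∈ nonZeroDivisors Γ(X, V.1))
    (hsJ : ∀ x ∈ J.sections V, IsLocalization.IsInteger Γ(X, V.1) (s • x)) :
    numeratorIdeal ((X.presheaf.map (homOfLE h).op).hom s) (J.sections W) =
      (numeratorIdeal s (J.sections V)).map (X.presheaf.map (homOfLE h).op).hom ∧
    ∀ y ∈ J.sections W,
      IsLocalization.IsInteger Γ(X, W.1) ((X.presheaf.map (homOfLE h).op).hom s • y) := by
  have e : pullbackFractions (X.presheaf.map (homOfLE h).op).hom (J.sections V) =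
      J.sections W := by
    obtain rfl : W = X.affineBasicOpen g := Subtype.ext hW
    exact J.map_basicOpen V g
  rw [← e]
  exact numeratorIdeal_pullbackFractions _
    (fun r hr ↦ Scheme.map_mem_nonZeroDivisors h hr) hs hsJ

theorem smul_sections_basicOpen_le_one_iff (P : X.IdealSheafData) {V W : X.affineOpens}
    (h : W.1 ≤ V.1) {g : Γ(X, V.1)} (hW : W.1 = X.basicOpen g) {s : Γ(X, V.1)}
    (hs : s ∈ nonZeroDivisors Γ(X, V.1))
    (hsJ : ∀ x ∈ J.sections V, IsLocalization.IsInteger Γ(X, V.1) (s • x)) :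
    P.ideal W • J.sections W ≤ 1 ↔
      (P.ideal V * numeratorIdeal s (J.sections V)).map (X.presheaf.map (homOfLE h).op).hom ≤
      (Ideal.span {s}).map (X.presheaf.map (homOfLE h).op).hom := by
  obtain ⟨h₁, h₂⟩ := J.numeratorIdeal_basicOpen h hW hs hsJ
  have e : P.ideal W = (P.ideal V).map (X.presheaf.map (homOfLE h).op).hom :=
    (P.map_ideal (U := W) (V := V) h).symm
  rw [smul_le_one_iff_mul_numeratorIdeal_le (Scheme.map_mem_nonZeroDivisors h hs) h₂, h₁, e,
    Ideal.map_mul, Ideal.map_span, Set.image_singleton]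

/-- Whether `P` clears the denominators of `J` is a local question. -/
theorem smul_sections_le_one_of_forall_exists {P : X.IdealSheafData}
    (h : ∀ x : X, ∃ V : X.affineOpens, x ∈ V.1 ∧ P.ideal V • J.sections V ≤ 1)
    (V : X.affineOpens) : P.ideal V • J.sections V ≤ 1 := by
  obtain ⟨s, hs, hsJ⟩ := exists_isInteger_smul (J.fg V)
  rw [smul_le_one_iff_mul_numeratorIdeal_le hs hsJ]
  refine Scheme.ideal_le_of_forall_exists fun x hxV ↦ ?_
  obtain ⟨V', hxV', h'⟩ := h x
  obtain ⟨g, g', e, hxg⟩ := exists_basicOpen_le_affine_inter V.2 V'.2 x ⟨hxV, hxV'⟩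
  obtain ⟨W, hW⟩ : ∃ W : X.affineOpens, W.1 = X.basicOpen g := ⟨X.affineBasicOpen g, rfl⟩
  have hWV : W.1 ≤ V.1 := hW.trans_le (X.basicOpen_le g)
  refine ⟨W, hWV, hW ▸ hxg, (J.smul_sections_basicOpen_le_one_iff P hWV hW hs hsJ).mp ?_⟩
  obtain ⟨s', hs', hsJ'⟩ := exists_isInteger_smul (J.fg V')
  rw [J.smul_sections_basicOpen_le_one_iff P ((hW.trans e).trans_le (X.basicOpen_le g'))
    (hW.trans e) hs' hsJ']
  exact Ideal.map_mono ((smul_le_one_iff_mul_numeratorIdeal_le hs' hsJ').mp h')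

theorem IsFractionalFor.exists_smul_sections_le_one (hJ : J.IsFractionalFor Z)
    (V : X.affineOpens) : ∃ P ∈ Submonoid.closure Z, P.ideal V • J.sections V ≤ 1 := by
  refine Submodule.fg_induction (motive := fun N _ ↦ (N : Set _) ⊆ polarSections Z V →
    ∃ P ∈ Submonoid.closure Z, P.ideal V • N ≤ 1) ?_ ?_ (J.sections V) (J.fg V) (hJ V)
  · intro x hx
    obtain ⟨P, hP, h⟩ := hx (Submodule.mem_span_singleton_self x)
    refine ⟨P, hP, Submodule.smul_le.mpr fun d hd y hy ↦ ?_⟩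
    obtain ⟨c, rfl⟩ := Submodule.mem_span_singleton.mp hy
    rw [smul_comm]
    exact Submodule.smul_mem _ c (h d hd)
  · intro N₁ N₂ _ _ h₁ h₂ hle
    obtain ⟨P₁, hP₁, h₁⟩ := h₁ fun x hx ↦ hle (Submodule.mem_sup_left hx)
    obtain ⟨P₂, hP₂, h₂⟩ := h₂ fun x hx ↦ hle (Submodule.mem_sup_right hx)
    refine ⟨P₁ * P₂, mul_mem hP₁ hP₂, ?_⟩
    rw [Submodule.smul_sup, Scheme.IdealSheafData.ideal_mul, Pi.mul_apply]
    refine sup_le (mul_smul_le_one h₁ _) ?_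
    rw [mul_comm]
    exact mul_smul_le_one h₂ _

/-- On a quasi-compact scheme, a finite product of members of `Z` clears the denominators of `J`
everywhere. -/
theorem IsFractionalFor.exists_forall_smul_sections_le_one [CompactSpace X]
    (hJ : J.IsFractionalFor Z) :
    ∃ P ∈ Submonoid.closure Z, ∀ V, P.ideal V • J.sections V ≤ 1 := by
  suffices H : ∃ P ∈ Submonoid.closure Z, ∀ x ∈ (Set.univ : Set X),
      ∃ V : X.affineOpens, x ∈ V.1 ∧ P.ideal V • J.sections V ≤ 1 by
    obtain ⟨P, hP, h⟩ := H
    exact ⟨P, hP, smul_sections_le_one_of_forall_exists fun x ↦ h x trivial⟩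
  refine isCompact_univ.induction_on (p := fun S ↦ ∃ P ∈ Submonoid.closure Z, ∀ x ∈ S,
    ∃ V : X.affineOpens, x ∈ V.1 ∧ P.ideal V • J.sections V ≤ 1)
    ⟨1, one_mem _, fun x hx ↦ hx.elim⟩ ?_ ?_ ?_
  · rintro S S' hSS' ⟨P, hP, h⟩
    exact ⟨P, hP, fun x hx ↦ h x (hSS' hx)⟩
  · rintro S₁ S₂ ⟨P₁, hP₁, h₁⟩ ⟨P₂, hP₂, h₂⟩
    refine ⟨P₁ * P₂, mul_mem hP₁ hP₂, ?_⟩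
    rintro x (hx | hx)
    · obtain ⟨V, hxV, h⟩ := h₁ x hx
      exact ⟨V, hxV, mul_smul_le_one h _⟩
    · obtain ⟨V, hxV, h⟩ := h₂ x hx
      rw [mul_comm]
      exact ⟨V, hxV, mul_smul_le_one h _⟩
  · intro x _
    obtain ⟨V, hxV, -⟩ := Scheme.exists_affineOpens_le (U := ⊤) (x := x) trivial
    obtain ⟨P, hP, h⟩ := hJ.exists_smul_sections_le_one V
    exact ⟨V.1, mem_nhdsWithin_of_mem_nhds (V.1.2.mem_nhds hxV), P, hP, fun y hy ↦ ⟨V, hy, h⟩⟩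

/-- If `P J` consists of regular functions, then it is an ideal sheaf. -/
theorem exists_coeSubmodule_ideal_eq {P : X.IdealSheafData}
    (hP : ∀ V, P.ideal V • J.sections V ≤ 1) :
    ∃ T : X.IdealSheafData, ∀ V,
      IsLocalization.coeSubmodule (FractionRing Γ(X, V.1)) (T.ideal V) =
        P.ideal V • J.sections V := by
  let T (V : X.affineOpens) : Ideal Γ(X, V.1) :=
    (P.ideal V • J.sections V).comap (Algebra.linearMap Γ(X, V.1) (FractionRing Γ(X, V.1)))
  have hT : ∀ V, IsLocalization.coeSubmodule (FractionRing Γ(X, V.1)) (T V) =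
      P.ideal V • J.sections V := fun V ↦ Submodule.map_comap_eq_self <| by
    rw [← Submodule.one_eq_range]
    exact hP V
  -- Both sides become equal after multiplication by a denominator `s` of `J` over `V`.
  have key : ∀ {V W : X.affineOpens} (h : W.1 ≤ V.1) (g : Γ(X, V.1)) (_ : W.1 = X.basicOpen g),
      (T V).map (X.presheaf.map (homOfLE h).op).hom = T W := by
    intro V W h g hW
    obtain ⟨s, hs, hsJ⟩ := exists_isInteger_smul (J.fg V)
    obtain ⟨h₁, h₂⟩ := J.numeratorIdeal_basicOpen h hW hs hsJ
    refine Ideal.span_singleton_mul_right_injective_of_mem_nonZeroDivisors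
      (Scheme.map_mem_nonZeroDivisors h hs) ?_
    refine Eq.trans ?_ (span_singleton_mul_eq_mul_numeratorIdeal h₂ (hT W)).symm
    have e : P.ideal W = (P.ideal V).map (X.presheaf.map (homOfLE h).op).hom :=
      (P.map_ideal (U := W) (V := V) h).symm
    rw [h₁, e, ← Ideal.map_mul, ← span_singleton_mul_eq_mul_numeratorIdeal hsJ (hT V),
      Ideal.map_mul, Ideal.map_span, Set.image_singleton]
  exact ⟨{ ideal := T
           map_ideal_basicOpen := fun V g ↦ key (W := X.affineBasicOpen g) _ g rfl }, hT⟩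

theorem _root_.IsEffectiveCartier.of_mem_closure (hZ : ∀ D ∈ Z, IsEffectiveCartier D)
    {P : X.IdealSheafData} (hP : P ∈ Submonoid.closure Z) : IsEffectiveCartier P :=
  Submonoid.closure_induction (motive := fun P _ ↦ IsEffectiveCartier P) hZ
    IsEffectiveCartier.top (fun _ _ _ _ ↦ IsEffectiveCartier.mul) hP

theorem support_subset_of_mem_closure {P : X.IdealSheafData} (hP : P ∈ Submonoid.closure Z) :
    (P.support : Set X) ⊆ ⋃ D ∈ Z, (D.support : Set X) := by
  induction hP using Submonoid.closure_induction with
  | mem D hD => exact Set.subset_biUnion_of_mem (u := fun D : X.IdealSheafData ↦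
      (D.support : Set X)) hD
  | one => simp
  | mul D E _ _ hD hE => simpa using ⟨hD, hE⟩

/-- Off the zero locus of `J` the product `P J` contains `P`. -/
theorem support_subset_zeroLocus_union {P T : X.IdealSheafData}
    (hT : ∀ V, IsLocalization.coeSubmodule (FractionRing Γ(X, V.1)) (T.ideal V) =
      P.ideal V • J.sections V) : (T.support : Set X) ⊆ J.zeroLocus ∪ P.support := by
  intro x hxT
  by_contra hx
  rw [Set.mem_union, not_or] at hx
  obtain ⟨hxJ, hxP⟩ := hx
  simp only [zeroLocus, Set.mem_ofPred_eq] at hxJ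
  push Not at hxJ
  obtain ⟨V, hxV, a, ha, hxa⟩ := hxJ
  have hxT : x ∈ T.support := hxT
  have hxP : x ∉ P.support := hxP
  rw [Scheme.IdealSheafData.mem_support_iff_of_mem hxV, Scheme.mem_zeroLocus_iff] at hxT hxP
  push Not at hxP
  obtain ⟨b, hb, hxb⟩ := hxP
  obtain ⟨t, ht, e⟩ := (IsLocalization.mem_coeSubmodule _ _).mp
    ((hT V).ge (Submodule.smul_mem_smul hb ha))
  rw [Algebra.smul_def, ← map_mul] at e
  have e := IsFractionRing.injective _ _ e
  refine hxT t ht ?_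
  rw [e, Scheme.basicOpen_mul]
  exact ⟨hxb, hxa⟩

/-- If `J` is integral over `I`, then the product of `J` with a finite product of members of `Z` is
an ideal sheaf cosupported in `Z` on whose blow-up `I` and `J` become equal. -/
theorem IsIntegralOver.exists_isBlowup [AlgebraicGeometry.IsNoetherian X] (h : IsIntegralOver I J)
    (hIJ : I ≤ J) (hZ : ∀ D ∈ Z, IsEffectiveCartier D) (hJ : J.IsFractionalFor Z)
    (hJZ : J.zeroLocus ⊆ ⋃ D ∈ Z, (D.support : Set X)) :
    ∃ P T : X.IdealSheafData, IsEffectiveCartier P ∧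
      (∀ V, IsLocalization.coeSubmodule (FractionRing Γ(X, V.1)) (T.ideal V) =
        P.ideal V • J.sections V) ∧
      (T.support : Set X) ⊆ ⋃ D ∈ Z, (D.support : Set X) ∧
      ∃ (Y : Scheme.{u}) (f : Y ⟶ X), IsBlowup f T ∧ PullbackEq f I J := by
  obtain ⟨P, hP, hPJ⟩ := hJ.exists_forall_smul_sections_le_one
  obtain ⟨T, hT⟩ := exists_coeSubmodule_ideal_eq hPJ
  obtain ⟨Y, f, hf⟩ := _root_.exists_isBlowup T
  exact ⟨P, T, .of_mem_closure hZ hP, hT, (support_subset_zeroLocus_union hT).trans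
    (Set.union_subset hJZ (support_subset_of_mem_closure hP)), Y, f, hf, h.pullbackEq hIJ P hT hf⟩

theorem IsIntegralOver.isIntegralExtension [AlgebraicGeometry.IsNoetherian X]
    (h : IsIntegralOver I J) (hIJ : I ≤ J) (hZ : ∀ D ∈ Z, IsEffectiveCartier D)
    (hJ : J.IsFractionalFor Z) (hJZ : J.zeroLocus ⊆ ⋃ D ∈ Z, (D.support : Set X)) :
    IsIntegralExtension Z I J := by
  obtain ⟨P, T, -, -, hTZ, H⟩ := h.exists_isBlowup hIJ hZ hJ hJZ
  refine ⟨T, fun V ↦ ?_, hTZ, H⟩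
  have : IsNoetherianRing Γ(X, V.1) := IsLocallyNoetherian.component_noetherian V
  exact IsNoetherian.noetherian _

theorem IsIntegralOver.eqAfterBlowup [AlgebraicGeometry.IsNoetherian X]
    (h : IsIntegralOver I J) (hIJ : I ≤ J) (hZ : ∀ D ∈ Z, IsEffectiveCartier D)
    (hJ : J.IsFractionalFor Z) (hJZ : J.zeroLocus ⊆ ⋃ D ∈ Z, (D.support : Set X)) :
    EqAfterBlowup I J := by
  obtain ⟨P, T, hP, hT, -, Y, f, hf, hpb⟩ := h.exists_isBlowup hIJ hZ hJ hJZ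
  exact ⟨Y, f, ⟨P, T, hP, hT, hf⟩, hpb⟩

end FractionalIdealSheaf

end

theorem mainTheorem3 (X : Scheme.{u}) [AlgebraicGeometry.IsNoetherian X]
    (Z : Set X.IdealSheafData) (hZ : ∀ D ∈ Z, IsEffectiveCartier D)
    (I J : FractionalIdealSheaf X) (hIJ : I ≤ J) (hJ : J.IsFractionalFor Z)
    (hJZ : J.zeroLocus ⊆ ⋃ D ∈ Z, (D.support : Set X)) :
    List.TFAE [
      FractionalIdealSheaf.IsIntegralExtension Z I J,
      ∀ Z' : Set X.IdealSheafData, (∀ D ∈ Z', IsEffectiveCartier D) → J.IsFractionalFor Z' →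
        J.zeroLocus ⊆ ⋃ D ∈ Z', (D.support : Set X) →
        FractionalIdealSheaf.IsIntegralExtension Z' I J,
      FractionalIdealSheaf.IsIntegralOver I J,
      FractionalIdealSheaf.EqAfterBlowup I J] := by
  tfae_have 1 → 3 := fun h ↦ h.isIntegralOver hZ hIJ
  tfae_have 3 → 2 := fun h Z' hZ' hJ' hJZ' ↦ h.isIntegralExtension hIJ hZ' hJ' hJZ'
  tfae_have 2 → 1 := fun h ↦ h Z hZ hJ hJZ
  tfae_have 3 → 4 := fun h ↦ h.eqAfterBlowup hIJ hZ hJ hJZ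
  tfae_have 4 → 3 := fun h ↦ h.isIntegralOver hIJ
  tfae_finish
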